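/- Let $(\mathcal A,\otimes,k)$ be a bicomplete abelian category with a closed symmetric monoidal structure, and let $\mathcal P$ be a symmetric operad in $\mathcal A$ (each $\mathcal P_n$ carrying a right action of $\Sigma_n$) that is reduced: $\mathcal P_0=0$, and the unit $k\to\mathcal P_1$ is an isomorphism. Write $\mathcal P(V)=\bigoplus_{n}\mathcal P_n\otimes_{\Sigma_n}V^{\otimes n}$ for the Schur functor, with the monad multiplication $\mu^{\mathcal P}:\mathcal P(\mathcal P(V))\to\mathcal P(V)$ induced by the composition of the operad. A $\mathcal P$-algebra is an algebra $(A,\mu^A:\mathcal P(A)\to A)$ over this monad. For objects $B,X$ of $\mathcal A$ put $$\mathcal P\circ(B|X)=\bigoplus_{n}\mathcal P_n\otimes_{\Sigma_n}\bigl((X\oplus B)^{\otimes n}/B^{\otimes n}\bigr);$$ it is identified with the kernel of $\mathcal P(X\oplus B)\to\mathcal P(B)$, so that $\mathcal P(X\oplus B)=\mathcal P\circ(B|X)\oplus\mathcal P(B)$. An internal action of a $\mathcal P$-algebra $B$ on a $\mathcal P$-algebra $X$ is a morphism $\rho:\mathcal P\circ(B|X)\to X$ of $\mathcal A$ such that 1.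 the composite $\mathcal P(X)\to\mathcal P\circ(B|X)\xrightarrow{\rho}X$, whose first arrow is induced by $X\hookrightarrow X\oplus B$, is $\mu^X$; 2. the two morphisms $\rho\circ\bigl(\mathcal P\circ(\mu^B|\rho)\bigr)$ and $\rho\circ\mu^{\mathcal P}$ from $\mathcal P\circ\bigl(\mathcal P(B)\,|\,\mathcal P\circ(B|X)\bigr)$ to $X$ are equal, where $\mu^{\mathcal P}$ here denotes the restriction $\mathcal P\circ(\mathcal P(B)|\mathcal P\circ(B|X))\to\mathcal P\circ(B|X)$ of the multiplication $\mathcal P(\mathcal P(X\oplus B))\to\mathcal P(X\oplus B)$ to the indicated summands. Let $\mathrm{Act}(\mathcal P\text{-alg})$ be the category whose objects are the triples $(B,X,\rho)$, with $\rho$ an internal action of $B$ on $X$, and whose morphisms $(B,X,\rho)\to(B',X',\rho')$ are the pairs of $\mathcal P$-algebra morphisms $g:B\to B'$, $f:X\to X'$ with $\rho'\circ(\mathcal P\circ(g|f))=f\circ\rho$. Let $\mathrm{SplitEpi}(\mathcal P\text{-alg})$ be the category of split short exact sequences $0\to X\xrightarrow{i}E\xrightarrow{p}B\to0$ of $\mathcal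 P$-algebras with a chosen section $s:B\to E$ of $p$ that is a morphism of $\mathcal P$-algebras; its morphisms are the triples of $\mathcal P$-algebra morphisms that commute with $i$, $p$ and $s$. **Theorem.** (a) For every internal action $\rho$ of $B$ on $X$, the morphism $$\mathcal P(X\oplus B)=\mathcal P\circ(B|X)\oplus\mathcal P(B)\xrightarrow{\begin{pmatrix}\rho&0\\0&\mu^B\end{pmatrix}}X\oplus B$$ makes $X\oplus B$ a $\mathcal P$-algebra, and $0\to X\to X\oplus B\to B\to 0$, with the canonical inclusions and projection and the section $B\to X\oplus B$, is a split short exact sequence of $\mathcal P$-algebras. (b) For every split short exact sequence $0\to X\xrightarrow{i}E\xrightarrow{p}B\to0$ of $\mathcal P$-algebras with section $s$, the unique morphism $\rho:\mathcal P\circ(B|X)\to X$ for which $i\circ\rho$ is the composite $\mathcal P\circ(B|X)\hookrightarrow\mathcal P(X\oplus B)\xrightarrow{\mathcal P((i,s))}\mathcal P(E)\xrightarrow{\mu^E}E$ is an internal action of $B$ on $X$. (c) The constructions (a) and (b), which act on morphisms by $(g,f)\mapsto(f,f\oplus g,g)$ and by $(f,h,g)\mapsto(g,f)$, are functors, and they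 are quasi-inverse equivalences of categories $$\mathrm{Act}(\mathcal P\text{-alg})\simeq\mathrm{SplitEpi}(\mathcal P\text{-alg}).$$ -/

import Mathlib

open CategoryTheory Limits MonoidalCategory

universe v u

noncomputable section

namespace OperadAction

/-! ### Finite sequences and block permutations -/

/-- Finite sequences of length `n`, built by appending an entry on the right. -/
inductive Vec (α : Type*) : ℕ → Type _
  | nil : Vec α 0
  | snoc {n : ℕ} (v : Vec α n) (a : α) : Vec α (n + 1)

namespace Vec

variable {α β : Type*}

/-- Apply a function to every entry. -/
def map (f : α → β) : {n : ℕ} → Vec α n → Vec β n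
  | _, nil => nil
  | _, snoc v a => snoc (map f v) (f a)

/-- Concatenation. -/
def append {m : ℕ} (u : Vec α m) : {n : ℕ} → Vec α n → Vec α (m + n)
  | _, nil => u
  | _, snoc v a => snoc (append u v) a

/-- The constant sequence. -/
def replicate (a : α) : (n : ℕ) → Vec α n
  | 0 => nil
  | n + 1 => snoc (replicate a n) a

/-- The sum of the entries. -/
def sum : {n : ℕ} → Vec ℕ n → ℕ
  | _, nil => 0
  | _, snoc v a => sum v + a

/-- Concatenation of a sequence of sequences. -/
def flatten : {n : ℕ} → (v : Vec (Σ m, Vec α m) n) → Vec α (v.map Sigma.fst).sum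
  | _, nil => nil
  | _, snoc v l => append (flatten v) l.2

/-- Exchange the last two entries (if there are two). -/
def swapLast : {n : ℕ} → Vec α n → Vec α n
  | _, nil => nil
  | _, snoc nil a => snoc nil a
  | _, snoc (snoc v a) b => snoc (snoc v b) a

/-- Exchange the entries at positions `j` and `j + 1`, counted from the right and from `0`
(nothing happens if there are no such positions). -/
def swapAt : (j : ℕ) → {n : ℕ} → Vec α n → Vec α n
  | 0, _, v => swapLast v
  | _ + 1, _, nil => nil
  | j + 1, _, snoc v a => snoc (swapAt j v) a

theorem sum_append {m n : ℕ} (u : Vec ℕ m) (v : Vec ℕ n) :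
    (u.append v).sum = u.sum + v.sum := by
  induction v with
  | nil => rfl
  | snoc v a ih => simp only [append, sum, ih, Nat.add_assoc]

theorem sum_replicate_one (n : ℕ) : (replicate 1 n).sum = n := by
  induction n with
  | zero => rfl
  | succ n ih => simp only [replicate, sum, ih]

theorem sum_flatten {n : ℕ} (v : Vec (Σ m, Vec ℕ m) n) :
    v.flatten.sum = (v.map fun l => l.2.sum).sum := by
  induction v with
  | nil => rfl
  | snoc v l ih => simp only [flatten, map, sum, sum_append, ih]

end Vec

/-- The block sum `e ⊕ f` of two bijections: `e` on the first block, `f` on the second one. -/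
def blockSum {a a' b b' : ℕ} (e : Fin a ≃ Fin a') (f : Fin b ≃ Fin b') :
    Fin (a + b) ≃ Fin (a' + b') :=
  finSumFinEquiv.symm.trans ((e.sumCongr f).trans finSumFinEquiv)

/-- The bijection that exchanges the last two of three consecutive blocks of sizes `s`, `a`, `b`,
keeping the order inside each block. -/
def blockComm (s a b : ℕ) : Fin (s + a + b) ≃ Fin (s + b + a) where
  toFun i := ⟨if i.1 < s then i.1 else if i.1 < s + a then i.1 + b else i.1 - a, by
    have := i.2; split_ifs <;> omega⟩
  invFun i := ⟨if i.1 < s then i.1 else if i.1 < s + b then i.1 + a else i.1 - b, by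
    have := i.2; split_ifs <;> omega⟩
  left_inv i := by
    have := i.2
    ext; dsimp only; split_ifs <;> omega
  right_inv i := by
    have := i.2
    ext; dsimp only; split_ifs <;> omega

/-- The transposition of the last two elements of `Fin n` (the identity if `n < 2`). -/
def swapLastPerm : (n : ℕ) → Fin n ≃ Fin n
  | 0 => Equiv.refl _
  | 1 => Equiv.refl _
  | n + 2 => blockComm n 1 1

/-- The adjacent transposition of the positions `j` and `j + 1` of `Fin n`, counted from the right
and from `0` (the identity if `n < j + 2`). For fixed `n`, these generate the symmetric group. -/
def swapPerm : (j n : ℕ) → (Fin n ≃ Fin n)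
  | 0, n => swapLastPerm n
  | _ + 1, 0 => Equiv.refl _
  | j + 1, n + 1 => blockSum (swapPerm j n) (Equiv.refl (Fin 1))

/-- The block permutation that exchanges the last two blocks, for blocks of sizes `k`. -/
def blockSwapLast : {n : ℕ} → (k : Vec ℕ n) → (Fin k.sum ≃ Fin k.swapLast.sum)
  | _, .nil => Equiv.refl _
  | _, .snoc .nil _ => Equiv.refl _
  | _, .snoc (.snoc k a) b => blockComm k.sum a b

/-- The block permutation induced by `swapPerm j n` on consecutive blocks of sizes `k₁, …, kₙ`. -/
def blockSwap : (j : ℕ) → {n : ℕ} → (k : Vec ℕ n) → (Fin k.sum ≃ Fin (k.swapAt j).sum)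
  | 0, _, k => blockSwapLast k
  | _ + 1, _, .nil => Equiv.refl _
  | j + 1, _, .snoc k a => blockSum (blockSwap j k) (Equiv.refl (Fin a))

/-- Sequences of bijections `Fin kᵢ ≃ Fin k'ᵢ`, for `i = 1, …, n`. -/
inductive VecEquiv : {n : ℕ} → Vec ℕ n → Vec ℕ n → Type
  | nil : VecEquiv .nil .nil
  | snoc {n : ℕ} {k k' : Vec ℕ n} {a a' : ℕ} (E : VecEquiv k k') (e : Fin a ≃ Fin a') :
      VecEquiv (k.snoc a) (k'.snoc a')

/-- The block sum of a sequence of bijections. -/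
def VecEquiv.sum : {n : ℕ} → {k k' : Vec ℕ n} → VecEquiv k k' → (Fin k.sum ≃ Fin k'.sum)
  | _, _, _, .nil => Equiv.refl _
  | _, _, _, .snoc E e => blockSum E.sum e

/-! ### Tensor products of finite sequences of objects -/

section Tensor

variable {C : Type u} [Category.{v} C] [MonoidalCategory C]

/-- The tensor product `F a₁ ⊗ ⋯ ⊗ F aₙ`. -/
def tens {α : Type*} (F : α → C) : {n : ℕ} → Vec α n → C
  | _, .nil => 𝟙_ C
  | _, .snoc v a => tens F v ⊗ F a

/-- The tensor product of the morphisms `φ aᵢ`. -/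
def tensMap {α β : Type*} {F : α → C} {G : β → C} (f : α → β) (φ : ∀ a, F a ⟶ G (f a)) :
    {n : ℕ} → (v : Vec α n) → (tens F v ⟶ tens G (v.map f))
  | _, .nil => 𝟙 _
  | _, .snoc v a => tensMap f φ v ⊗ₘ φ a

/-- The isomorphism between the tensor product of two blocks and that of their concatenation. -/
def tensAppend {α : Type*} (F : α → C) {m : ℕ} (u : Vec α m) :
    {n : ℕ} → (v : Vec α n) → (tens F u ⊗ tens F v ⟶ tens F (u.append v))
  | _, .nil => (ρ_ _).hom
  | _, .snoc v a => (α_ _ _ _).inv ≫ tensAppend F u v ▷ F a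

/-- The tensor power `X^{⊗ n}`. -/
def tpow (X : C) : ℕ → C
  | 0 => 𝟙_ C
  | n + 1 => tpow X n ⊗ X

/-- Functoriality of tensor powers. -/
def tpowMap {X Y : C} (f : X ⟶ Y) : (n : ℕ) → (tpow X n ⟶ tpow Y n)
  | 0 => 𝟙 _
  | n + 1 => tpowMap f n ⊗ₘ f

/-- The isomorphism `X^{⊗ a} ⊗ X^{⊗ b} ≅ X^{⊗ (a + b)}`. -/
def tpowAdd (X : C) (a : ℕ) : (b : ℕ) → (tpow X a ⊗ tpow X b ≅ tpow X (a + b))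
  | 0 => ρ_ _
  | b + 1 => (α_ _ _ _).symm ≪≫ whiskerRightIso (tpowAdd X a b) X

/-- The tensor product of a sequence of morphisms `F a → X`, as a morphism to a tensor power. -/
def tensToPow {α : Type*} {F : α → C} {X : C} (φ : ∀ a, F a ⟶ X) :
    {n : ℕ} → (v : Vec α n) → (tens F v ⟶ tpow X n)
  | _, .nil => 𝟙 _
  | _, .snoc v a => tensToPow φ v ⊗ₘ φ a

variable [SymmetricCategory C]

/-- The symmetry exchanging the last two of three tensor factors. -/
def rightSwap (A B D : C) : (A ⊗ B) ⊗ D ⟶ (A ⊗ D) ⊗ B :=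
  (α_ A B D).hom ≫ A ◁ (β_ B D).hom ≫ (α_ A D B).inv

/-- The symmetry exchanging the last two factors. -/
def tensSwapLast {α : Type*} (F : α → C) :
    {n : ℕ} → (v : Vec α n) → (tens F v ⟶ tens F v.swapLast)
  | _, .nil => 𝟙 _
  | _, .snoc .nil _ => 𝟙 _
  | _, .snoc (.snoc v a) b => rightSwap (tens F v) (F a) (F b)

/-- The symmetry exchanging the factors at positions `j` and `j + 1`, counted from the right. -/
def tensSwap {α : Type*} (F : α → C) :
    (j : ℕ) → {n : ℕ} → (v : Vec α n) → (tens F v ⟶ tens F (v.swapAt j))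
  | 0, _, v => tensSwapLast F v
  | _ + 1, _, .nil => 𝟙 _
  | j + 1, _, .snoc v a => tensSwap F j v ▷ F a

/-- The symmetry exchanging the last two factors of `X^{⊗ n}`. -/
def tpowSwapLast (X : C) : (n : ℕ) → (tpow X n ⟶ tpow X n)
  | 0 => 𝟙 _
  | 1 => 𝟙 _
  | n + 2 => rightSwap (tpow X n) X X

/-- The action of the adjacent transposition `swapPerm j n` on `X^{⊗ n}`. -/
def tpowSwap (X : C) : (j n : ℕ) → (tpow X n ⟶ tpow X n)
  | 0, n => tpowSwapLast X n
  | _ + 1, 0 => 𝟙 _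
  | j + 1, n + 1 => tpowSwap X j n ▷ X

/-- The rearrangement
`⨂ᵢ (F mᵢ ⊗ ⨂ⱼ F lᵢⱼ) → (⨂ᵢ F mᵢ) ⊗ (⨂ᵢ ⨂ⱼ F lᵢⱼ)` given by the symmetry. -/
def unzipTens (F : ℕ → C) : {n : ℕ} → (v : Vec (Σ m, Vec ℕ m) n) →
    (tens (fun l : Σ m, Vec ℕ m => F l.1 ⊗ tens F l.2) v ⟶
      tens F (v.map Sigma.fst) ⊗ tens F v.flatten)
  | _, .nil => (λ_ (𝟙_ C)).inv
  | _, .snoc v l => unzipTens F v ▷ _ ≫ tensorμ _ _ _ _ ≫ _ ◁ tensAppend F v.flatten l.2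

/-- The rearrangement
`⨂ᵢ (F kᵢ ⊗ X^{⊗ kᵢ}) → (⨂ᵢ F kᵢ) ⊗ X^{⊗ (k₁ + ⋯ + kₙ)}` given by the symmetry. -/
def unzipPow (F : ℕ → C) (X : C) : {n : ℕ} → (k : Vec ℕ n) →
    (tens (fun a : ℕ => F a ⊗ tpow X a) k ⟶ tens F k ⊗ tpow X k.sum)
  | _, .nil => (λ_ (𝟙_ C)).inv
  | _, .snoc k a => unzipPow F X k ▷ _ ≫ tensorμ _ _ _ _ ≫ _ ◁ (tpowAdd X k.sum a).hom

/-- The tensor product of a sequence of right actions of bijections. -/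
def tensAct {F : ℕ → C} (act : ∀ {m n : ℕ}, (Fin m ≃ Fin n) → (F n ⟶ F m)) :
    {n : ℕ} → {k k' : Vec ℕ n} → VecEquiv k k' → (tens F k' ⟶ tens F k)
  | _, _, _, .nil => 𝟙 _
  | _, _, _, .snoc E e => tensAct act E ⊗ₘ act e

/-- The morphism `𝟙 → F 1 ⊗ ⋯ ⊗ F 1` given by a morphism `𝟙 → F 1`. -/
def tensOne {F : ℕ → C} (one : 𝟙_ C ⟶ F 1) : (n : ℕ) → (𝟙_ C ⟶ tens F (Vec.replicate 1 n))
  | 0 => 𝟙 _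
  | n + 1 => (λ_ (𝟙_ C)).inv ≫ (tensOne one n ⊗ₘ one)

end Tensor

/-! ### Symmetric operads -/

/-- A symmetric operad in a symmetric monoidal category. The right actions of the symmetric groups
on the objects of `n`-ary operations are recorded as the (contravariant) action of all bijections
`Fin m ≃ Fin n`; such a bijection exists only if `m = n`. Equivariance of the composition with
respect to the outer symmetric group is stated for the adjacent transpositions, which generate. -/
structure SymmOperad (C : Type u) [Category.{v} C] [MonoidalCategory C] [SymmetricCategory C] where
  /-- the object of `n`-ary operations -/
  obj : ℕ → C
  /-- the right action of the symmetric groups -/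
  act : ∀ {m n : ℕ}, (Fin m ≃ Fin n) → (obj n ⟶ obj m)
  act_refl : ∀ n : ℕ, act (Equiv.refl (Fin n)) = 𝟙 (obj n)
  act_trans : ∀ {l m n : ℕ} (e : Fin l ≃ Fin m) (f : Fin m ≃ Fin n),
    act (e.trans f) = act f ≫ act e
  /-- the operadic unit -/
  one : 𝟙_ C ⟶ obj 1
  /-- the operadic composition `P n ⊗ P k₁ ⊗ ⋯ ⊗ P kₙ ⟶ P (k₁ + ⋯ + kₙ)` -/
  comp : ∀ {n : ℕ} (k : Vec ℕ n), obj n ⊗ tens obj k ⟶ obj k.sum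
  one_comp : ∀ a : ℕ, (one ⊗ₘ (λ_ (obj a)).inv) ≫ comp (Vec.nil.snoc a) =
    (λ_ (obj a)).hom ≫ act (finCongr (Nat.zero_add a))
  comp_one : ∀ n : ℕ, (ρ_ (obj n)).inv ≫ obj n ◁ tensOne one n ≫ comp (Vec.replicate 1 n) =
    act (finCongr (Vec.sum_replicate_one n))
  comp_assoc : ∀ {n : ℕ} (v : Vec (Σ m, Vec ℕ m) n),
    obj n ◁ unzipTens obj v ≫ (α_ _ _ _).inv ≫ comp (v.map Sigma.fst) ▷ _ ≫ comp v.flatten =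
      obj n ◁ tensMap (fun l : Σ m, Vec ℕ m => l.2.sum) (fun l => comp l.2) v ≫
        comp (v.map fun l => l.2.sum) ≫ act (finCongr (Vec.sum_flatten v))
  comp_act_inner : ∀ {n : ℕ} {k k' : Vec ℕ n} (E : VecEquiv k k'),
    obj n ◁ tensAct act E ≫ comp k = comp k' ≫ act E.sum
  comp_act_outer : ∀ {n : ℕ} (j : ℕ) (k : Vec ℕ n),
    act (swapPerm j n) ▷ tens obj k ≫ comp k =
      obj n ◁ tensSwap obj j k ≫ comp (k.swapAt j) ≫ act (blockSwap j k)

/-- The operad is reduced: `P 0 = 0`, and `P 1` is the tensor unit, through the operadic unit. -/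
structure SymmOperad.IsReduced {C : Type u} [Category.{v} C] [MonoidalCategory C]
    [SymmetricCategory C] (P : SymmOperad C) : Prop where
  isZero_zero : IsZero (P.obj 0)
  isIso_one : IsIso P.one

/-! ### Facts on block permutations and tensor powers -/

theorem blockSum_refl (a b : ℕ) :
    blockSum (Equiv.refl (Fin a)) (Equiv.refl (Fin b)) = Equiv.refl (Fin (a + b)) := by
  ext i; simp [blockSum]

theorem blockSum_trans {a a' a'' b b' b'' : ℕ} (e : Fin a ≃ Fin a') (e' : Fin a' ≃ Fin a'')
    (f : Fin b ≃ Fin b') (f' : Fin b' ≃ Fin b'') :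
    blockSum (e.trans e') (f.trans f') = (blockSum e f).trans (blockSum e' f') := by
  apply Equiv.ext
  intro i
  induction i using Fin.addCases <;> simp [blockSum]

theorem blockSum_left_val {a a' b b' : ℕ} (e : Fin a ≃ Fin a') (f : Fin b ≃ Fin b')
    (i : Fin (a + b)) (h : i.1 < a) : (blockSum e f i).1 = (e ⟨i.1, h⟩).1 := by
  have key : ∀ x : Fin a, blockSum e f (Fin.castAdd b x) = Fin.castAdd b' (e x) := by
    intro x; simp [blockSum]
  exact congrArg Fin.val (key ⟨i.1, h⟩)

theorem blockSum_right_val {a a' b b' : ℕ} (e : Fin a ≃ Fin a') (f : Fin b ≃ Fin b')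
    (i : Fin (a + b)) (h : ¬ i.1 < a) :
    (blockSum e f i).1 = a' + (f ⟨i.1 - a, by omega⟩).1 := by
  have key : ∀ x : Fin b, blockSum e f (Fin.natAdd a x) = Fin.natAdd a' (f x) := by
    intro x; simp [blockSum]
  have hi : i = Fin.natAdd a ⟨i.1 - a, by omega⟩ := by ext; simp; omega
  exact (congrArg (fun x => (blockSum e f x).1) hi).trans (congrArg Fin.val (key _))

theorem blockSum_zero {a a' : ℕ} (e : Fin a ≃ Fin a') :
    blockSum e (Equiv.refl (Fin 0)) = e := by
  apply Equiv.ext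
  intro i
  ext
  exact blockSum_left_val e _ i i.2

theorem blockSum_succ {a a' b b' : ℕ} (e : Fin a ≃ Fin a') (f : Fin b ≃ Fin b') :
    blockSum e (blockSum f (Equiv.refl (Fin 1))) =
      blockSum (blockSum e f) (Equiv.refl (Fin 1)) := by
  apply Equiv.ext
  intro i
  ext
  have hi := i.2
  by_cases h1 : i.1 < a
  · rw [blockSum_left_val _ _ _ h1, blockSum_left_val _ _ _ (by omega),
      blockSum_left_val _ _ _ (by simpa using h1)]
  · by_cases h2 : i.1 < a + b
    · rw [blockSum_right_val _ _ _ h1, blockSum_left_val _ _ _ (by simp; omega),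
        blockSum_left_val _ _ _ (by simpa using h2), blockSum_right_val _ _ _ (by simpa using h1)]
    · rw [blockSum_right_val _ _ _ h1, blockSum_right_val _ _ _ (by simp; omega),
        blockSum_right_val _ _ _ (by simpa using h2)]
      simp

theorem blockComm_zero_left (s a : ℕ) : blockComm s 0 a = Equiv.refl (Fin (s + a)) := by
  apply Equiv.ext; intro i; ext
  have := i.2
  change (if i.1 < s then _ else _) = i.1
  split_ifs <;> omega

theorem blockComm_zero_right (s a : ℕ) : blockComm s a 0 = Equiv.refl (Fin (s + a)) := by
  apply Equiv.ext; intro i; ext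
  have := i.2
  change (if i.1 < s then _ else _) = i.1
  split_ifs <;> omega

theorem blockComm_succ_one (s a : ℕ) : blockComm s (a + 1) 1 =
    (blockComm (s + a) 1 1).trans (blockSum (blockComm s a 1) (Equiv.refl (Fin 1))) := by
  apply Equiv.ext; intro i; ext
  have hi := i.2
  rw [Equiv.trans_apply]
  by_cases h : (blockComm (s + a) 1 1 i).1 < s + a + 1
  · rw [blockSum_left_val _ _ _ h]
    simp only [blockComm, Equiv.coe_fn_mk] at h ⊢
    split_ifs at h ⊢ <;> omega
  · rw [blockSum_right_val _ _ _ h]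
    simp only [blockComm, Equiv.coe_fn_mk] at h ⊢
    simp
    split_ifs at h ⊢ <;> omega

theorem blockComm_succ (s a b : ℕ) : blockComm s a (b + 1) =
    Equiv.trans (blockSum (blockComm s a b) (Equiv.refl (Fin 1))) (blockComm (s + b) a 1) := by
  apply Equiv.ext; intro i; ext
  have hi := i.2
  rw [Equiv.trans_apply]
  by_cases h : i.1 < s + a + b
  · have e := blockSum_left_val (blockComm s a b) (Equiv.refl (Fin 1)) i h
    simp only [blockComm, Equiv.coe_fn_mk] at e ⊢
    rw [e]
    split_ifs <;> omega
  · have e := blockSum_right_val (blockComm s a b) (Equiv.refl (Fin 1)) i h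
    simp only [blockComm, Equiv.coe_fn_mk, Equiv.refl_apply] at e ⊢
    rw [e]
    split_ifs <;> omega

theorem swapPerm_eq_refl : ∀ j n : ℕ, n ≤ j + 1 → swapPerm j n = Equiv.refl _
  | 0, 0, _ => rfl
  | 0, 1, _ => rfl
  | 0, n + 2, h => by omega
  | _ + 1, 0, _ => rfl
  | j + 1, n + 1, h => by
    rw [swapPerm, swapPerm_eq_refl j n (by omega), blockSum_refl]

section Tensor

variable {C : Type u} [Category.{v} C] [MonoidalCategory C]

theorem tpowMap_id (X : C) (n : ℕ) : tpowMap (𝟙 X) n = 𝟙 _ := by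
  induction n with
  | zero => rfl
  | succ n ih => simp only [tpowMap, ih, id_tensorHom_id]; rfl

theorem tpowMap_comp {X Y Z : C} (f : X ⟶ Y) (g : Y ⟶ Z) (n : ℕ) :
    tpowMap (f ≫ g) n = tpowMap f n ≫ tpowMap g n := by
  induction n with
  | zero => exact (Category.comp_id _).symm
  | succ n ih =>
    simp only [tpowMap, ih]
    exact (tensorHom_comp_tensorHom _ _ _ _).symm

theorem whisker_step {A A' B B' X Y : C} {t : A ⟶ A'} {s : B ⟶ B'} {φ : A ⟶ B} {ψ : A' ⟶ B'}
    (f : X ⟶ Y) (h : φ ≫ s = t ≫ ψ) : (φ ⊗ₘ f) ≫ s ▷ Y = t ▷ X ≫ (ψ ⊗ₘ f) := by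
  rw [tensorHom_comp_whiskerRight, whiskerRight_comp_tensorHom, h]

variable [SymmetricCategory C]

theorem rightSwap_natural {A B D A' B' D' : C} (f : A ⟶ A') (g : B ⟶ B') (h : D ⟶ D') :
    ((f ⊗ₘ g) ⊗ₘ h) ≫ rightSwap A' B' D' = rightSwap A B D ≫ ((f ⊗ₘ h) ⊗ₘ g) := by
  simp only [rightSwap, Category.assoc]
  rw [associator_naturality_assoc, tensorHom_comp_whiskerLeft_assoc,
    BraidedCategory.braiding_naturality, ← associator_inv_naturality,
    whiskerLeft_comp_tensorHom_assoc]

theorem rightSwap_step {A B D X : C} (m : A ⊗ B ⟶ D) :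
    A ◁ rightSwap B X X ≫ (α_ A (B ⊗ X) X).inv ≫ ((α_ A B X).inv ≫ m ▷ X) ▷ X =
      ((α_ A (B ⊗ X) X).inv ≫ ((α_ A B X).inv ≫ m ▷ X) ▷ X) ≫ rightSwap D X X := by
  have h : ((m ▷ X) ▷ X) ≫ rightSwap D X X = rightSwap (A ⊗ B) X X ≫ (m ▷ X) ▷ X := by
    simpa using rightSwap_natural m (𝟙 X) (𝟙 X)
  simp only [comp_whiskerRight, Category.assoc, h]
  simp only [← Category.assoc]
  congr 1
  simp only [rightSwap]
  monoidal

theorem tpowSwap_natural {X Y : C} (f : X ⟶ Y) : ∀ j n : ℕ,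
    tpowMap f n ≫ tpowSwap Y j n = tpowSwap X j n ≫ tpowMap f n
  | 0, 0 => rfl
  | 0, 1 => by simp [tpowSwap, tpowSwapLast]
  | 0, n + 2 => rightSwap_natural _ _ _
  | _ + 1, 0 => rfl
  | j + 1, n + 1 => by
    have ih := tpowSwap_natural f j n
    exact whisker_step f ih

theorem tpowSwap_eq_id (X : C) : ∀ j n : ℕ, n ≤ j + 1 → tpowSwap X j n = 𝟙 _
  | 0, 0, _ => rfl
  | 0, 1, _ => rfl
  | 0, n + 2, h => by omega
  | _ + 1, 0, _ => rfl
  | j + 1, n + 1, h => by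
    rw [tpowSwap, tpowSwap_eq_id X j n (by omega), id_whiskerRight]; rfl

theorem tensToPow_swapLast {α : Type*} {F : α → C} {X : C} (φ : ∀ a, F a ⟶ X) :
    ∀ {n : ℕ} (v : Vec α n), tensToPow φ v ≫ tpowSwapLast X n =
      tensSwapLast F v ≫ tensToPow φ v.swapLast
  | _, .nil => rfl
  | _, .snoc .nil a => by
      simp only [tpowSwapLast, tensSwapLast, Vec.swapLast]
      erw [Category.comp_id, Category.id_comp]
  | _, .snoc (.snoc v a) b => rightSwap_natural _ _ _

theorem tensToPow_swap {α : Type*} {F : α → C} {X : C} (φ : ∀ a, F a ⟶ X) :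
    ∀ (j : ℕ) {n : ℕ} (v : Vec α n), tensToPow φ v ≫ tpowSwap X j n =
      tensSwap F j v ≫ tensToPow φ (v.swapAt j)
  | 0, _, v => tensToPow_swapLast φ v
  | _ + 1, _, .nil => rfl
  | j + 1, _, .snoc v a => by
    have ih := tensToPow_swap φ j v
    exact whisker_step (φ a) ih

/-- `h` is a composite of adjacent symmetries that realizes the bijection `e`. -/
inductive Realizes (X : C) : ∀ {m n : ℕ}, (Fin m ≃ Fin n) → (tpow X m ⟶ tpow X n) → Prop
  | refl (n : ℕ) : Realizes X (Equiv.refl (Fin n)) (𝟙 _)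
  | trans {l m n : ℕ} {e : Fin l ≃ Fin m} {f : Fin m ≃ Fin n} {g : tpow X l ⟶ tpow X m}
      {h : tpow X m ⟶ tpow X n} (H : Realizes X e g) (K : Realizes X f h) :
      Realizes X (e.trans f) (g ≫ h)
  | swap (j n : ℕ) : Realizes X (swapPerm j n) (tpowSwap X j n)

theorem Realizes.snoc {X : C} {m n : ℕ} {e : Fin m ≃ Fin n} {h : tpow X m ⟶ tpow X n}
    (H : Realizes X e h) :
    Realizes X (m := m + 1) (n := n + 1) (blockSum e (Equiv.refl (Fin 1))) (h ▷ X) := by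
  induction H with
  | refl n =>
    rw [blockSum_refl, id_whiskerRight]; exact Realizes.refl (n + 1)
  | trans H K ih ih' =>
    have := Realizes.trans ih ih'
    rw [← blockSum_trans] at this
    rw [comp_whiskerRight]
    exact this
  | swap j n => exact Realizes.swap (j + 1) (n + 1)

theorem Realizes.blockSum_left {X : C} {m n : ℕ} {e : Fin m ≃ Fin n} {h : tpow X m ⟶ tpow X n}
    (H : Realizes X e h) (b : ℕ) : ∃ g : tpow X (m + b) ⟶ tpow X (n + b),
      Realizes X (blockSum e (Equiv.refl (Fin b))) g ∧
      h ▷ tpow X b ≫ (tpowAdd X n b).hom = (tpowAdd X m b).hom ≫ g := by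
  induction b with
  | zero => exact ⟨h, by rw [blockSum_zero]; exact H, by simp [tpowAdd, tpow]⟩
  | succ b ih =>
    obtain ⟨g, hg, hg'⟩ := ih
    refine ⟨g ▷ X, ?_, ?_⟩
    · have := hg.snoc
      rwa [← blockSum_succ, blockSum_refl] at this
    · simp only [tpowAdd, tpow, Iso.trans_hom, Iso.symm_hom, whiskerRightIso_hom, Category.assoc]
      rw [← comp_whiskerRight, ← hg', comp_whiskerRight, associator_inv_naturality_left_assoc]

theorem Realizes.blockSum_right (X : C) (a : ℕ) : ∀ (j b : ℕ),
    ∃ g : tpow X (a + b) ⟶ tpow X (a + b),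
      Realizes X (blockSum (Equiv.refl (Fin a)) (swapPerm j b)) g ∧
      tpow X a ◁ tpowSwap X j b ≫ (tpowAdd X a b).hom = (tpowAdd X a b).hom ≫ g
  | 0, 0 => ⟨𝟙 _, by
      rw [swapPerm_eq_refl 0 0 (by omega), blockSum_refl]; exact .refl _, by
      simp [tpowSwap_eq_id]⟩
  | 0, 1 => ⟨𝟙 _, by
      rw [swapPerm_eq_refl 0 1 (by omega), blockSum_refl]; exact .refl _, by
      simp [tpowSwap_eq_id]⟩
  | 0, b + 2 => ⟨tpowSwap X 0 (a + b + 2), by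
      have h : blockSum (Equiv.refl (Fin a)) (swapPerm 0 (b + 2)) = swapPerm 0 (a + b + 2) := by
        apply Equiv.ext; intro i; ext
        have hi := i.2
        by_cases h : i.1 < a
        · rw [blockSum_left_val _ _ _ h]
          simp only [swapPerm, swapLastPerm, blockComm, Equiv.coe_fn_mk, Equiv.refl_apply]
          split_ifs <;> omega
        · rw [blockSum_right_val _ _ _ h]
          simp only [swapPerm, swapLastPerm, blockComm, Equiv.coe_fn_mk]
          split_ifs <;> omega
      rw [h]; exact Realizes.swap 0 (a + b + 2), by
      exact rightSwap_step (tpowAdd X a b).hom⟩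
  | j + 1, 0 => ⟨𝟙 _, by
      rw [swapPerm_eq_refl _ 0 (by omega), blockSum_refl]; exact .refl _, by
      simp [tpowSwap_eq_id]⟩
  | j + 1, b + 1 => by
    obtain ⟨g, hg, hg'⟩ := Realizes.blockSum_right X a j b
    refine ⟨g ▷ X, ?_, ?_⟩
    · have := hg.snoc
      rwa [← blockSum_succ] at this
    · simp only [tpowAdd, tpow, tpowSwap, Iso.trans_hom, Iso.symm_hom, whiskerRightIso_hom,
        Category.assoc]
      rw [← comp_whiskerRight, ← hg', comp_whiskerRight, associator_inv_naturality_middle_assoc]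

end Tensor

section Symmetry

variable {C : Type u} [Category.{v} C] [MonoidalCategory C] [SymmetricCategory C]

theorem tensorμ_braiding (A₁ A₂ B₁ B₂ : C) :
    tensorμ A₁ A₂ B₁ B₂ ≫ ((β_ A₁ B₁).hom ⊗ₘ (β_ A₂ B₂).hom) =
      (β_ (A₁ ⊗ A₂) (B₁ ⊗ B₂)).hom ≫ tensorμ B₁ B₂ A₁ A₂ := by
  simp only [tensorμ, BraidedCategory.braiding_tensor_left_hom,
    BraidedCategory.braiding_tensor_right_hom]
  have h : (β_ A₁ B₂).hom ≫ (β_ B₂ A₁).hom = 𝟙 _ := SymmetricCategory.symmetry _ _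
  have h' : B₁ ◁ ((β_ A₁ B₂).hom ≫ (β_ B₂ A₁).hom) ▷ A₂ = 𝟙 _ := by rw [h]; simp
  symm
  calc
    _ = 𝟙 _ ⊗≫ A₁ ◁ (β_ A₂ B₁).hom ▷ B₂ ⊗≫ ((A₁ ⊗ B₁) ◁ (β_ A₂ B₂).hom ≫
          (β_ A₁ B₁).hom ▷ (B₂ ⊗ A₂)) ⊗≫
          B₁ ◁ ((β_ A₁ B₂).hom ≫ (β_ B₂ A₁).hom) ▷ A₂ ⊗≫ 𝟙 _ := by
      rw [whisker_exchange]
      monoidal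
    _ = _ := by
      rw [h', whisker_exchange, MonoidalCategory.tensorHom_def]
      monoidal

theorem tensorμ_rightSwap (T₁ T₂ A₁ A₂ B₁ B₂ : C) :
    rightSwap (T₁ ⊗ T₂) (A₁ ⊗ A₂) (B₁ ⊗ B₂) ≫ tensorμ T₁ T₂ B₁ B₂ ▷ (A₁ ⊗ A₂) ≫
        tensorμ (T₁ ⊗ B₁) (T₂ ⊗ B₂) A₁ A₂ =
      tensorμ T₁ T₂ A₁ A₂ ▷ (B₁ ⊗ B₂) ≫ tensorμ (T₁ ⊗ A₁) (T₂ ⊗ A₂) B₁ B₂ ≫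
        (rightSwap T₁ A₁ B₁ ⊗ₘ rightSwap T₂ A₂ B₂) := by
  have key : ∀ X₁ X₂ Y₁ Y₂ Z₁ Z₂ : C, tensorμ X₁ X₂ Y₁ Y₂ ▷ (Z₁ ⊗ Z₂) ≫
        tensorμ (X₁ ⊗ Y₁) (X₂ ⊗ Y₂) Z₁ Z₂ = (α_ (X₁ ⊗ X₂) (Y₁ ⊗ Y₂) (Z₁ ⊗ Z₂)).hom ≫
        ((X₁ ⊗ X₂) ◁ tensorμ Y₁ Y₂ Z₁ Z₂) ≫ tensorμ X₁ X₂ (Y₁ ⊗ Z₁) (Y₂ ⊗ Z₂) ≫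
        ((α_ X₁ Y₁ Z₁).inv ⊗ₘ (α_ X₂ Y₂ Z₂).inv) := by
    intro X₁ X₂ Y₁ Y₂ Z₁ Z₂
    rw [← tensor_associativity_assoc]
    simp
  rw [key, reassoc_of% key]
  simp only [rightSwap, Category.assoc, Iso.inv_hom_id_assoc]
  congr 1
  rw [← whiskerLeft_comp_assoc, ← tensorμ_braiding, tensorHom_comp_tensorHom]
  simp only [Iso.inv_hom_id_assoc]
  rw [← tensorHom_comp_tensorHom, ← tensorμ_natural_right_assoc, whiskerLeft_comp_assoc]

theorem rightSwap_tensor_middle (S A X Y : C) :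
    (α_ S A X).inv ▷ Y ≫ rightSwap (S ⊗ A) X Y ≫ rightSwap S A Y ▷ X =
      rightSwap S (A ⊗ X) Y ≫ (α_ (S ⊗ Y) A X).inv := by
  simp only [rightSwap, BraidedCategory.braiding_tensor_left_hom]
  monoidal

theorem rightSwap_tensor_right (S A B X : C) :
    (α_ (S ⊗ A) B X).inv ≫ rightSwap S A B ▷ X ≫ rightSwap (S ⊗ B) A X =
      rightSwap S A (B ⊗ X) ≫ (α_ S B X).inv ▷ A := by
  simp only [rightSwap, BraidedCategory.braiding_tensor_right_hom]
  monoidal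

theorem rightSwap_unit_middle (S X : C) :
    (ρ_ S).hom ▷ X = rightSwap S (𝟙_ C) X ≫ (ρ_ (S ⊗ X)).hom := by
  simp [rightSwap]

theorem rightSwap_unit_right (S A : C) :
    (ρ_ (S ⊗ A)).hom = rightSwap S A (𝟙_ C) ≫ (ρ_ S).hom ▷ A := by
  simp [rightSwap]

theorem rightSwap_natural_left {S S' : C} (f : S ⟶ S') (A B : C) :
    (f ▷ A) ▷ B ≫ rightSwap S' A B = rightSwap S A B ≫ (f ▷ B) ▷ A := by
  simpa using rightSwap_natural f (𝟙 A) (𝟙 B)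

theorem realizes_blockComm_one (X : C) (s a : ℕ) :
    ∃ h : tpow X (s + a + 1) ⟶ tpow X (s + 1 + a), Realizes X (blockComm s a 1) h ∧
      (tpowAdd X s a).hom ▷ X ≫ h =
        rightSwap (tpow X s) (tpow X a) X ≫ (tpowAdd X (s + 1) a).hom := by
  induction a with
  | zero =>
    refine ⟨𝟙 _, ?_, ?_⟩
    · have := Realizes.refl (X := X) (s + 1)
      rw [← blockComm_zero_left] at this
      exact this
    · exact (Category.comp_id _).trans (rightSwap_unit_middle _ _)
  | succ a ih =>
    obtain ⟨h, H, e⟩ := ih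
    refine ⟨tpowSwap X 0 (s + a + 2) ≫ h ▷ X, ?_, ?_⟩
    · have := Realizes.trans (Realizes.swap (X := X) 0 (s + a + 2)) H.snoc
      rw [show swapPerm 0 (s + a + 2) = blockComm (s + a) 1 1 from rfl] at this
      have e := blockComm_succ_one s a
      exact e ▸ this
    · have aux : ∀ {S A T U : C} (m : S ⊗ A ⟶ T) (m' : (S ⊗ X) ⊗ A ⟶ U) (h : T ⊗ X ⟶ U),
          m ▷ X ≫ h = rightSwap S A X ≫ m' →
          ((α_ S A X).inv ≫ m ▷ X) ▷ X ≫ rightSwap T X X ≫ h ▷ X =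
            rightSwap S (A ⊗ X) X ≫ (α_ (S ⊗ X) A X).inv ≫ m' ▷ X := by
        intro S A T U m m' h e
        rw [← reassoc_of% rightSwap_tensor_middle, ← comp_whiskerRight, ← e, comp_whiskerRight,
          comp_whiskerRight, Category.assoc, ← reassoc_of% rightSwap_natural_left]
      exact aux _ _ _ e

theorem realizes_blockComm (X : C) (s a b : ℕ) :
    ∃ h : tpow X (s + a + b) ⟶ tpow X (s + b + a), Realizes X (blockComm s a b) h ∧
      (tpowAdd X s a).hom ▷ tpow X b ≫ (tpowAdd X (s + a) b).hom ≫ h =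
        rightSwap (tpow X s) (tpow X a) (tpow X b) ≫
          (tpowAdd X s b).hom ▷ tpow X a ≫ (tpowAdd X (s + b) a).hom := by
  induction b with
  | zero =>
    refine ⟨𝟙 _, ?_, ?_⟩
    · have := Realizes.refl (X := X) (s + a)
      rw [← blockComm_zero_right] at this
      exact this
    · have aux : ∀ {S A T : C} (m : S ⊗ A ⟶ T), m ▷ (𝟙_ C) ≫ (ρ_ T).hom ≫ 𝟙 _ =
          rightSwap S A (𝟙_ C) ≫ (ρ_ S).hom ▷ A ≫ m := by
        intro S A T m
        rw [← reassoc_of% rightSwap_unit_right]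
        simp
      exact aux _
  | succ b ih =>
    obtain ⟨h, H, e⟩ := ih
    obtain ⟨h', H', e'⟩ := realizes_blockComm_one X (s + b) a
    refine ⟨h ▷ X ≫ h', ?_, ?_⟩
    · have := Realizes.trans H.snoc H'
      have e := blockComm_succ s a b
      exact e ▸ this
    · have aux : ∀ {S A B T U V W Z : C} (m : S ⊗ A ⟶ T) (n : T ⊗ B ⟶ U) (h : U ⟶ V)
          (k : S ⊗ B ⟶ W) (l : W ⊗ A ⟶ V) (h' : V ⊗ X ⟶ Z) (l' : (W ⊗ X) ⊗ A ⟶ Z),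
          m ▷ B ≫ n ≫ h = rightSwap S A B ≫ k ▷ A ≫ l →
          l ▷ X ≫ h' = rightSwap W A X ≫ l' →
          m ▷ (B ⊗ X) ≫ ((α_ T B X).inv ≫ n ▷ X) ≫ h ▷ X ≫ h' =
            rightSwap S A (B ⊗ X) ≫ ((α_ S B X).inv ≫ k ▷ X) ▷ A ≫ l' := by
        intro S A B T U V W Z m n h k l h' l' e e'
        rw [comp_whiskerRight_assoc, ← reassoc_of% rightSwap_tensor_right,
          ← reassoc_of% rightSwap_natural_left, ← e', ← comp_whiskerRight_assoc,
          ← comp_whiskerRight_assoc,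
          show (rightSwap S A B ≫ k ▷ A) ≫ l = m ▷ B ≫ n ≫ h by rw [Category.assoc, e]]
        simp
      exact aux _ _ _ _ _ _ _ e e'

end Symmetry

/-! ### The Schur functor of an operad -/

section Endomorphisms

variable {C : Type u} [Category.{v} C] [MonoidalCategory C]

/-- A sequence of endomorphisms acting on a tensor product. -/
def tensEndo {F : ℕ → C} (d : ∀ a : ℕ, ℕ → (F a ⟶ F a)) :
    {n : ℕ} → (js k : Vec ℕ n) → (tens F k ⟶ tens F k)
  | _, .nil, .nil => 𝟙 _
  | _, .snoc js j, .snoc k a => tensEndo d js k ⊗ₘ d a j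

theorem tensEndo_self {F : ℕ → C} (d : ∀ a : ℕ, ℕ → (F a ⟶ F a)) (h : ∀ a, d a a = 𝟙 _) :
    ∀ {n : ℕ} (k : Vec ℕ n), tensEndo d k k = 𝟙 _
  | _, .nil => rfl
  | _, .snoc k a => by
    have h' : tensEndo d k k ⊗ₘ d a a = 𝟙 (tens F k ⊗ F a) := by
      rw [tensEndo_self d h k, h, id_tensorHom_id]
    exact h'

theorem tensEndo_toPow {F : ℕ → C} (d d' : ∀ a : ℕ, ℕ → (F a ⟶ F a)) {Q : C}
    (q : ∀ a, F a ⟶ Q) (h : ∀ a j, d a j ≫ q a = d' a j ≫ q a) :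
    ∀ {n : ℕ} (js k : Vec ℕ n),
      tensEndo d js k ≫ tensToPow q k = tensEndo d' js k ≫ tensToPow q k
  | _, .nil, .nil => rfl
  | _, .snoc js j, .snoc k a => by
    have ih := tensEndo_toPow d d' q h js k
    have h' : (tensEndo d js k ⊗ₘ d a j) ≫ (tensToPow q k ⊗ₘ q a) =
        (tensEndo d' js k ⊗ₘ d' a j) ≫ (tensToPow q k ⊗ₘ q a) := by
      rw [tensorHom_comp_tensorHom, tensorHom_comp_tensorHom, ih, h]
    exact h'

end Endomorphisms

section Descent

variable {C : Type u} [Category.{v} C] [MonoidalCategory C] [SymmetricCategory C]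

theorem rightSwap_rightSwap (L A B : C) : rightSwap L A B ≫ rightSwap L B A = 𝟙 _ := by
  simp only [rightSwap, Category.assoc, Iso.inv_hom_id_assoc]
  rw [← whiskerLeft_comp_assoc, SymmetricCategory.symmetry]
  simp

/-- Morphisms out of `L ⊗ Q^{⊗ n}` are described by families of morphisms out of
`L ⊗ F k₁ ⊗ ⋯ ⊗ F kₙ`, if this is so for `n = 1`. -/
theorem tens_desc {F : ℕ → C} {Q : C} (d d' : ∀ a : ℕ, ℕ → (F a ⟶ F a)) (q : ∀ a, F a ⟶ Q)
    (hd : ∀ a, d a a = 𝟙 _) (hd' : ∀ a, d' a a = 𝟙 _) (hq : ∀ a j, d a j ≫ q a = d' a j ≫ q a)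
    (U : ∀ (L Z : C) (ψ : ∀ a, L ⊗ F a ⟶ Z), (∀ a j, L ◁ d a j ≫ ψ a = L ◁ d' a j ≫ ψ a) →
      ∃! m : L ⊗ Q ⟶ Z, ∀ a, L ◁ q a ≫ m = ψ a) :
    ∀ (n : ℕ) (L Z : C) (φ : ∀ k : Vec ℕ n, L ⊗ tens F k ⟶ Z),
      (∀ js k, L ◁ tensEndo d js k ≫ φ k = L ◁ tensEndo d' js k ≫ φ k) →
      ∃! m : L ⊗ tpow Q n ⟶ Z, ∀ k, L ◁ tensToPow q k ≫ m = φ k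
  | 0, L, Z, φ, _ => by
    have key : ∀ m : L ⊗ 𝟙_ C ⟶ Z, L ◁ 𝟙 (𝟙_ C) ≫ m = m := fun m => by simp
    refine ⟨φ .nil, ?_, ?_⟩
    · intro k; cases k; exact key _
    · intro m hm; exact (key m).symm.trans (hm .nil)
  | n + 1, L, Z, φ, hφ => by
    have IH := tens_desc d d' q hd hd' hq U n
    have ext : ∀ {L : C} (f g : L ⊗ tpow Q n ⟶ Z),
        (∀ k, L ◁ tensToPow q k ≫ f = L ◁ tensToPow q k ≫ g) → f = g := by
      intro L f g h
      refine (IH L Z (fun k => L ◁ tensToPow q k ≫ g) ?_).unique h (fun k => rfl)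
      intro js k
      rw [← whiskerLeft_comp_assoc, tensEndo_toPow d d' q hq, whiskerLeft_comp_assoc]
    obtain ⟨φs, hφs⟩ : ∃ φs : ∀ (k : Vec ℕ n) (a : ℕ), L ⊗ (tens F k ⊗ F a) ⟶ Z,
      ∀ k a, φs k a = φ (k.snoc a) := ⟨fun k a => φ (k.snoc a), fun _ _ => rfl⟩
    have hs : ∀ (js k : Vec ℕ n) (j a : ℕ), L ◁ (tensEndo d js k ⊗ₘ d a j) ≫ φs k a =
        L ◁ (tensEndo d' js k ⊗ₘ d' a j) ≫ φs k a := by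
      intro js k j a
      rw [hφs]
      exact hφ (js.snoc j) (k.snoc a)
    let φ' : ∀ (a : ℕ) (k : Vec ℕ n), (L ⊗ F a) ⊗ tens F k ⟶ Z :=
      fun a k => rightSwap L (F a) (tens F k) ≫ (α_ L (tens F k) (F a)).hom ≫ φs k a
    have nat₁ : ∀ {T T' A : C} (e : T ⟶ T'), (L ⊗ A) ◁ e ≫ rightSwap L A T' =
        rightSwap L A T ≫ (L ◁ e) ▷ A := by
      intro T T' A e
      simpa using rightSwap_natural (𝟙 L) (𝟙 A) e
    have nat₂ : ∀ {T A A' : C} (e : A ⟶ A'), (L ◁ e) ▷ T ≫ rightSwap L A' T =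
        rightSwap L A T ≫ (L ⊗ T) ◁ e := by
      intro T A A' e
      simpa using rightSwap_natural (𝟙 L) e (𝟙 T)
    have inv₁ : ∀ (a : ℕ) (js k : Vec ℕ n),
        (L ⊗ F a) ◁ tensEndo d js k ≫ φ' a k = (L ⊗ F a) ◁ tensEndo d' js k ≫ φ' a k := by
      intro a js k
      have h := hs js k a a
      rw [hd, hd', tensorHom_id, tensorHom_id] at h
      simp only [φ']
      rw [reassoc_of% nat₁, reassoc_of% nat₁, associator_naturality_middle_assoc,
        associator_naturality_middle_assoc, h]
    have inv₂ : ∀ (a j : ℕ) (k : Vec ℕ n),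
        (L ◁ d a j) ▷ tens F k ≫ φ' a k = (L ◁ d' a j) ▷ tens F k ≫ φ' a k := by
      intro a j k
      have h := hs k k j a
      rw [tensEndo_self d hd, tensEndo_self d' hd', id_tensorHom, id_tensorHom] at h
      simp only [φ']
      rw [reassoc_of% nat₂, reassoc_of% nat₂, associator_naturality_right_assoc,
        associator_naturality_right_assoc, h]
    choose m hm hm' using fun a => IH (L ⊗ F a) Z (φ' a) (inv₁ a)
    let ψ : ∀ a, (L ⊗ tpow Q n) ⊗ F a ⟶ Z := fun a => rightSwap L (tpow Q n) (F a) ≫ m a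
    have inv₃ : ∀ a j, (L ⊗ tpow Q n) ◁ d a j ≫ ψ a = (L ⊗ tpow Q n) ◁ d' a j ≫ ψ a := by
      intro a j
      have h : (L ◁ d a j) ▷ tpow Q n ≫ m a = (L ◁ d' a j) ▷ tpow Q n ≫ m a := by
        refine ext _ _ fun k => ?_
        rw [whisker_exchange_assoc, whisker_exchange_assoc, hm, inv₂]
      simp only [ψ]
      rw [reassoc_of% nat₁, reassoc_of% nat₁, h]
    obtain ⟨r, hr, hr'⟩ := U (L ⊗ tpow Q n) Z ψ inv₃
    have key : ∀ (a : ℕ) (k : Vec ℕ n) (x : (L ⊗ tpow Q n) ⊗ Q ⟶ Z),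
        L ◁ (tensToPow q k ⊗ₘ q a) ≫ (α_ L (tpow Q n) Q).inv ≫ x =
          (α_ L (tens F k) (F a)).inv ≫ (L ◁ tensToPow q k) ▷ F a ≫
            (L ⊗ tpow Q n) ◁ q a ≫ x := by
      intro a k x
      rw [MonoidalCategory.tensorHom_def, whiskerLeft_comp_assoc,
        associator_inv_naturality_right_assoc, associator_inv_naturality_middle_assoc]
    refine ⟨(α_ L (tpow Q n) Q).inv ≫ r, ?_, ?_⟩
    · intro k
      cases k with
      | snoc k a =>
        refine (key a k r).trans ?_
        rw [hr]
        simp only [ψ]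
        rw [reassoc_of% nat₂, hm]
        simp only [φ']
        rw [reassoc_of% rightSwap_rightSwap, Iso.inv_hom_id_assoc, hφs]
    · intro x₀ hx
      obtain ⟨x, rfl⟩ : ∃ x : L ⊗ (tpow Q n ⊗ Q) ⟶ Z, x = x₀ := ⟨x₀, rfl⟩
      have hx' : (α_ L (tpow Q n) Q).hom ≫ x = r := by
        refine hr' _ fun a => ?_
        have : rightSwap L (F a) (tpow Q n) ≫
            (L ⊗ tpow Q n) ◁ q a ≫ (α_ L (tpow Q n) Q).hom ≫ x = m a := by
          refine hm' a _ fun k => ?_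
          have h := key a k ((α_ L (tpow Q n) Q).hom ≫ x)
          rw [Iso.inv_hom_id_assoc] at h
          have h' := h.symm.trans ((hx (k.snoc a)).trans (hφs k a).symm)
          rw [reassoc_of% nat₁]
          simp only [φ']
          rw [← h', Iso.hom_inv_id_assoc]
        simp only [ψ]
        rw [← this, reassoc_of% rightSwap_rightSwap]
      rw [← hx']
      exact (Iso.inv_hom_id_assoc _ _).symm

end Descent

section Schur

variable {C : Type u} [Category.{v} C] [MonoidalCategory C] [SymmetricCategory C]

section Coinvariants

variable [Preadditive C] [HasCokernels C] [HasCoproducts.{0} C]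

/-- The coinvariants `P n ⊗_{Σₙ} V`, where `t j` is the action on `V` of the adjacent transposition
`swapPerm j n`: the quotient of `P n ⊗ V` by the relations `p s ⊗ x = p ⊗ s x`, for `s` in the
generating set of the adjacent transpositions. -/
def coinv (P : SymmOperad C) (n : ℕ) (V : C) (t : ℕ → (V ⟶ V)) : C :=
  cokernel (Sigma.desc fun j : ℕ => P.act (swapPerm j n) ▷ V - P.obj n ◁ t j)

/-- The quotient morphism. -/
def coinvMk (P : SymmOperad C) (n : ℕ) (V : C) (t : ℕ → (V ⟶ V)) :
    P.obj n ⊗ V ⟶ coinv P n V t :=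
  cokernel.π _

variable (P : SymmOperad C) {n : ℕ} {V W Z : C} {t : ℕ → (V ⟶ V)} {t' : ℕ → (W ⟶ W)}

theorem coinv_condition (j : ℕ) :
    P.act (swapPerm j n) ▷ V ≫ coinvMk P n V t = P.obj n ◁ t j ≫ coinvMk P n V t := by
  have h := cokernel.condition (Sigma.desc fun j : ℕ => P.act (swapPerm j n) ▷ V - P.obj n ◁ t j)
  have h' := Sigma.ι (fun _ : ℕ => P.obj n ⊗ V) j ≫= h
  rw [Sigma.ι_desc_assoc, comp_zero, Preadditive.sub_comp, sub_eq_zero] at h'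
  exact h'

/-- The universal property of the coinvariants. -/
def coinvDesc (f : P.obj n ⊗ V ⟶ Z)
    (h : ∀ j, P.act (swapPerm j n) ▷ V ≫ f = P.obj n ◁ t j ≫ f) : coinv P n V t ⟶ Z :=
  cokernel.desc _ f (by
    ext j
    rw [Sigma.ι_desc_assoc, comp_zero, Preadditive.sub_comp, h, sub_self])

theorem coinvMk_desc (f : P.obj n ⊗ V ⟶ Z)
    (h : ∀ j, P.act (swapPerm j n) ▷ V ≫ f = P.obj n ◁ t j ≫ f) :
    coinvMk P n V t ≫ coinvDesc P f h = f :=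
  cokernel.π_desc _ _ _

theorem coinvMk_desc_assoc (f : P.obj n ⊗ V ⟶ Z)
    (h : ∀ j, P.act (swapPerm j n) ▷ V ≫ f = P.obj n ◁ t j ≫ f) {Y : C} (g : Z ⟶ Y) :
    coinvMk P n V t ≫ coinvDesc P f h ≫ g = f ≫ g := by
  rw [← Category.assoc, coinvMk_desc]

theorem coinv_hom_ext {f g : coinv P n V t ⟶ Z}
    (h : coinvMk P n V t ≫ f = coinvMk P n V t ≫ g) : f = g :=
  coequalizer.hom_ext h

/-- The morphism on coinvariants induced by an equivariant morphism. -/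
def coinvMap (φ : V ⟶ W) (h : ∀ j, φ ≫ t' j = t j ≫ φ) : coinv P n V t ⟶ coinv P n W t' :=
  coinvDesc P (P.obj n ◁ φ ≫ coinvMk P n W t') (by
    intro j
    rw [← whisker_exchange_assoc, coinv_condition, ← whiskerLeft_comp_assoc, h,
      whiskerLeft_comp_assoc])

theorem coinvMk_map (φ : V ⟶ W) (h : ∀ j, φ ≫ t' j = t j ≫ φ) :
    coinvMk P n V t ≫ coinvMap P φ h = P.obj n ◁ φ ≫ coinvMk P n W t' :=
  coinvMk_desc _ _ _

theorem coinvMk_map_assoc (φ : V ⟶ W) (h : ∀ j, φ ≫ t' j = t j ≫ φ) {Y : C}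
    (g : coinv P n W t' ⟶ Y) :
    coinvMk P n V t ≫ coinvMap P φ h ≫ g = P.obj n ◁ φ ≫ coinvMk P n W t' ≫ g := by
  rw [← Category.assoc, coinvMk_map, Category.assoc]

/-- The Schur functor `P(X) = ⨁ₙ P n ⊗_{Σₙ} X^{⊗ n}`. -/
def schur (X : C) : C :=
  ∐ fun n : ℕ => coinv P n (tpow X n) (fun j => tpowSwap X j n)

/-- The inclusion of the `n`-th summand. -/
def schurIn (X : C) (n : ℕ) : coinv P n (tpow X n) (fun j => tpowSwap X j n) ⟶ schur P X :=
  Sigma.ι (fun n : ℕ => coinv P n (tpow X n) (fun j => tpowSwap X j n)) n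

/-- The canonical morphism `P n ⊗ X^{⊗ n} → P(X)`. -/
def schurι (X : C) (n : ℕ) : P.obj n ⊗ tpow X n ⟶ schur P X :=
  coinvMk P n (tpow X n) (fun j => tpowSwap X j n) ≫ schurIn P X n

/-- Functoriality of the Schur functor. -/
def schurMap {X Y : C} (f : X ⟶ Y) : schur P X ⟶ schur P Y :=
  Limits.Sigma.map fun n : ℕ => coinvMap P (tpowMap f n) (fun j => tpowSwap_natural f j n)

theorem schurι_condition (X : C) (n j : ℕ) :
    P.act (swapPerm j n) ▷ tpow X n ≫ schurι P X n =
      P.obj n ◁ tpowSwap X j n ≫ schurι P X n := by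
  simp only [schurι]
  exact (reassoc_of% coinv_condition P j) (schurIn P X n)

theorem schurι_realizes {X : C} {m n : ℕ} {e : Fin m ≃ Fin n} {h : tpow X m ⟶ tpow X n}
    (H : Realizes X e h) :
    P.act e ▷ tpow X m ≫ schurι P X m = P.obj n ◁ h ≫ schurι P X n := by
  induction H with
  | refl n => simp [P.act_refl]
  | trans H K ih ih' =>
    rw [P.act_trans, comp_whiskerRight_assoc, ih, ← whisker_exchange_assoc, ih',
      whiskerLeft_comp_assoc]
  | swap j n => exact schurι_condition P X n j

/-- The universal property of the Schur functor. -/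
def schurDesc {X : C} (f : ∀ n, P.obj n ⊗ tpow X n ⟶ Z)
    (h : ∀ n j, P.act (swapPerm j n) ▷ tpow X n ≫ f n = P.obj n ◁ tpowSwap X j n ≫ f n) :
    schur P X ⟶ Z :=
  Sigma.desc fun n => coinvDesc P (f n) (h n)

theorem schurι_desc {X : C} (f : ∀ n, P.obj n ⊗ tpow X n ⟶ Z)
    (h : ∀ n j, P.act (swapPerm j n) ▷ tpow X n ≫ f n = P.obj n ◁ tpowSwap X j n ≫ f n) (n : ℕ) :
    schurι P X n ≫ schurDesc P f h = f n := by
  have h' : schurIn P X n ≫ schurDesc P f h = coinvDesc P (f n) (h n) := Sigma.ι_desc _ _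
  rw [schurι, Category.assoc, h', coinvMk_desc]

theorem schur_hom_ext {X : C} {f g : schur P X ⟶ Z}
    (h : ∀ n, schurι P X n ≫ f = schurι P X n ≫ g) : f = g := by
  refine Sigma.hom_ext _ _ fun n => coinv_hom_ext P ?_
  have := h n
  rw [schurι, Category.assoc, Category.assoc] at this
  exact this

end Coinvariants

/-! ### The multiplication of the Schur functor -/

section Multiplication

/-- The sequence of the adjacent transpositions `swapPerm jᵢ kᵢ`. -/
def swapEquiv : {n : ℕ} → (js k : Vec ℕ n) → VecEquiv k k
  | _, .nil, .nil => .nil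
  | _, .snoc js j, .snoc k a => .snoc (swapEquiv js k) (swapPerm j a)

variable (P : SymmOperad C)

theorem tensEndo_act_unzip (X : C) : ∀ {n : ℕ} (js k : Vec ℕ n),
    tensEndo (F := fun a => P.obj a ⊗ tpow X a)
        (fun a j => P.act (swapPerm j a) ▷ tpow X a) js k ≫ unzipPow P.obj X k =
      unzipPow P.obj X k ≫ tensAct P.act (swapEquiv js k) ▷ tpow X k.sum
  | _, .nil, .nil => by
    refine (Category.id_comp _).trans ?_
    refine (Category.comp_id _).symm.trans ?_
    exact congrArg _ (id_whiskerRight _ _).symm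
  | _, .snoc js j, .snoc k a => by
    have ih := tensEndo_act_unzip X js k
    have aux : ∀ {T U V Q A D : C} (e : T ⟶ T) (z : T ⟶ U ⊗ V) (f : U ⟶ U) (p : Q ⟶ Q)
        (m : V ⊗ A ⟶ D), e ≫ z = z ≫ f ▷ V →
        (e ⊗ₘ (p ▷ A)) ≫ z ▷ (Q ⊗ A) ≫ tensorμ U V Q A ≫ (U ⊗ Q) ◁ m =
          (z ▷ (Q ⊗ A) ≫ tensorμ U V Q A ≫ (U ⊗ Q) ◁ m) ≫ (f ⊗ₘ p) ▷ D := by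
      intro T U V Q A D e z f p m h
      have nat := tensorμ_natural f (𝟙 V) p (𝟙 A)
      simp only [tensorHom_id, id_whiskerRight] at nat
      rw [tensorHom_comp_whiskerRight_assoc, h]
      simp only [Category.assoc]
      rw [whisker_exchange, ← reassoc_of% nat, whiskerRight_comp_tensorHom_assoc]
    exact aux _ _ _ _ _ ih

theorem tensEndo_swap_unzip (X : C) : ∀ {n : ℕ} (js k : Vec ℕ n),
    ∃ g, Realizes X (swapEquiv js k).sum g ∧
      tensEndo (F := fun a => P.obj a ⊗ tpow X a)
          (fun a j => P.obj a ◁ tpowSwap X j a) js k ≫ unzipPow P.obj X k =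
        unzipPow P.obj X k ≫ tens P.obj k ◁ g
  | _, .nil, .nil => by
    refine ⟨𝟙 _, Realizes.refl 0, ?_⟩
    refine (Category.id_comp _).trans ?_
    refine (Category.comp_id _).symm.trans ?_
    exact congrArg _ (whiskerLeft_id _ _).symm
  | _, .snoc js j, .snoc k a => by
    obtain ⟨g, hg, ih⟩ := tensEndo_swap_unzip X js k
    obtain ⟨g₁, h₁, e₁⟩ := hg.blockSum_left a
    obtain ⟨g₂, h₂, e₂⟩ := Realizes.blockSum_right X k.sum j a
    refine ⟨g₁ ≫ g₂, ?_, ?_⟩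
    · have := h₁.trans h₂
      rw [← blockSum_trans] at this
      exact this
    · have aux : ∀ {T U V Q A D : C} (e : T ⟶ T) (z : T ⟶ U ⊗ V) (f : V ⟶ V) (p : A ⟶ A)
          (m : V ⊗ A ⟶ D) (g₁ g₂ : D ⟶ D), e ≫ z = z ≫ U ◁ f → f ▷ A ≫ m = m ≫ g₁ →
          V ◁ p ≫ m = m ≫ g₂ →
          (e ⊗ₘ (Q ◁ p)) ≫ z ▷ (Q ⊗ A) ≫ tensorμ U V Q A ≫ (U ⊗ Q) ◁ m =
            (z ▷ (Q ⊗ A) ≫ tensorμ U V Q A ≫ (U ⊗ Q) ◁ m) ≫ (U ⊗ Q) ◁ (g₁ ≫ g₂) := by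
        intro T U V Q A D e z f p m g₁ g₂ h h₁ h₂
        have nat := tensorμ_natural (𝟙 U) f (𝟙 Q) p
        simp only [id_tensorHom, whiskerLeft_id] at nat
        rw [tensorHom_comp_whiskerRight_assoc, h]
        simp only [Category.assoc]
        rw [← whiskerLeft_comp, ← reassoc_of% h₁, ← h₂, ← MonoidalCategory.tensorHom_def_assoc,
          whiskerLeft_comp, ← reassoc_of% nat, whiskerRight_comp_tensorHom_assoc]
      exact aux _ _ _ _ _ _ _ ih e₁ e₂

theorem tensSwapLast_unzip (X : C) : ∀ {n : ℕ} (k : Vec ℕ n),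
    ∃ g, Realizes X (blockSwapLast k) g ∧
      tensSwapLast (fun a => P.obj a ⊗ tpow X a) k ≫ unzipPow P.obj X k.swapLast =
        unzipPow P.obj X k ≫ (tensSwapLast P.obj k ⊗ₘ g)
  | _, .nil => ⟨𝟙 _, Realizes.refl 0, by
      refine (Category.id_comp _).trans ?_
      refine (Category.comp_id _).symm.trans ?_
      exact congrArg _ (id_tensorHom_id _ _).symm⟩
  | _, .snoc .nil a => ⟨𝟙 _, Realizes.refl _, by
      refine (Category.id_comp _).trans ?_
      refine (Category.comp_id _).symm.trans ?_
      exact congrArg _ (id_tensorHom_id _ _).symm⟩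
  | _, .snoc (.snoc k a) b => by
    obtain ⟨g, hg, e⟩ := realizes_blockComm X k.sum a b
    refine ⟨g, hg, ?_⟩
    have aux : ∀ {T U V A₁ A₂ B₁ B₂ W Z W' Z' : C} (z : T ⟶ U ⊗ V) (m : V ⊗ A₂ ⟶ W)
        (n : W ⊗ B₂ ⟶ Z) (m' : V ⊗ B₂ ⟶ W') (n' : W' ⊗ A₂ ⟶ Z') (g : Z ⟶ Z'),
        m ▷ B₂ ≫ n ≫ g = rightSwap V A₂ B₂ ≫ m' ▷ A₂ ≫ n' →
        rightSwap T (A₁ ⊗ A₂) (B₁ ⊗ B₂) ≫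
          ((z ▷ (B₁ ⊗ B₂) ≫ tensorμ U V B₁ B₂ ≫ (U ⊗ B₁) ◁ m') ▷ (A₁ ⊗ A₂) ≫
            tensorμ (U ⊗ B₁) W' A₁ A₂ ≫ ((U ⊗ B₁) ⊗ A₁) ◁ n') =
        ((z ▷ (A₁ ⊗ A₂) ≫ tensorμ U V A₁ A₂ ≫ (U ⊗ A₁) ◁ m) ▷ (B₁ ⊗ B₂) ≫
            tensorμ (U ⊗ A₁) W B₁ B₂ ≫ ((U ⊗ A₁) ⊗ B₁) ◁ n) ≫ (rightSwap U A₁ B₁ ⊗ₘ g) := by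
      intro T U V A₁ A₂ B₁ B₂ W Z W' Z' z m n m' n' g h
      have nat : ∀ {U V W Q A : C} (m : V ⟶ W), (U ◁ m) ▷ (Q ⊗ A) ≫ tensorμ U W Q A =
          tensorμ U V Q A ≫ (U ⊗ Q) ◁ (m ▷ A) := by
        intro U V W Q A m
        have := tensorμ_natural (𝟙 U) m (𝟙 Q) (𝟙 A)
        simpa only [id_tensorHom, whiskerLeft_id, tensorHom_id, id_whiskerRight] using this
      simp only [comp_whiskerRight, Category.assoc]
      rw [reassoc_of% nat, reassoc_of% nat, ← reassoc_of% rightSwap_natural_left]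
      have K := tensorμ_rightSwap U V A₁ A₂ B₁ B₂
      rw [reassoc_of% K]
      simp only [← whiskerLeft_comp_assoc, ← whiskerLeft_comp]
      rw [whiskerLeft_comp_tensorHom, tensorHom_comp_whiskerLeft, Category.assoc, h]
    exact aux _ _ _ _ _ _ e

theorem tensSwap_unzip (X : C) : ∀ (j : ℕ) {n : ℕ} (k : Vec ℕ n),
    ∃ g, Realizes X (blockSwap j k) g ∧
      tensSwap (fun a => P.obj a ⊗ tpow X a) j k ≫ unzipPow P.obj X (k.swapAt j) =
        unzipPow P.obj X k ≫ (tensSwap P.obj j k ⊗ₘ g)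
  | 0, _, k => tensSwapLast_unzip P X k
  | _ + 1, _, .nil => ⟨𝟙 _, Realizes.refl 0, by
      refine (Category.id_comp _).trans ?_
      refine (Category.comp_id _).symm.trans ?_
      exact congrArg _ (id_tensorHom_id _ _).symm⟩
  | j + 1, _, .snoc k a => by
    obtain ⟨g, hg, ih⟩ := tensSwap_unzip X j k
    obtain ⟨g₁, h₁, e₁⟩ := hg.blockSum_left a
    refine ⟨g₁, h₁, ?_⟩
    have aux : ∀ {T T' U V U' V' Q A D D' : C} (e : T ⟶ T') (z : T ⟶ U ⊗ V) (z' : T' ⟶ U' ⊗ V')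
        (f : U ⟶ U') (g : V ⟶ V') (m : V ⊗ A ⟶ D) (m' : V' ⊗ A ⟶ D') (g₁ : D ⟶ D'),
        e ≫ z' = z ≫ (f ⊗ₘ g) → g ▷ A ≫ m' = m ≫ g₁ →
        e ▷ (Q ⊗ A) ≫ z' ▷ (Q ⊗ A) ≫ tensorμ U' V' Q A ≫ (U' ⊗ Q) ◁ m' =
          (z ▷ (Q ⊗ A) ≫ tensorμ U V Q A ≫ (U ⊗ Q) ◁ m) ≫ ((f ▷ Q) ⊗ₘ g₁) := by
      intro T T' U V U' V' Q A D D' e z z' f g m m' g₁ h h₁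
      rw [← comp_whiskerRight_assoc, h, comp_whiskerRight_assoc, tensorμ_natural_left_assoc,
        tensorHom_comp_whiskerLeft, h₁]
      simp only [Category.assoc]
      rw [whiskerLeft_comp_tensorHom]
    exact aux _ _ _ _ _ _ _ _ ih e₁

/-- The morphism `P n ⊗ ⨂ᵢ (P kᵢ ⊗ X^{⊗ kᵢ}) → P (k₁ + ⋯ + kₙ) ⊗ X^{⊗ (k₁ + ⋯ + kₙ)}` given by
the symmetry and the composition of the operad. -/
def opComp (X : C) {n : ℕ} (k : Vec ℕ n) :
    P.obj n ⊗ tens (fun a => P.obj a ⊗ tpow X a) k ⟶ P.obj k.sum ⊗ tpow X k.sum :=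
  P.obj n ◁ unzipPow P.obj X k ≫ (α_ _ _ _).inv ≫ P.comp k ▷ tpow X k.sum

variable [Preadditive C] [HasCokernels C] [HasCoproducts.{0} C]

theorem opComp_inner (X : C) {n : ℕ} (js k : Vec ℕ n) :
    P.obj n ◁ tensEndo (F := fun a => P.obj a ⊗ tpow X a)
        (fun a j => P.act (swapPerm j a) ▷ tpow X a) js k ≫ opComp P X k ≫ schurι P X k.sum =
      P.obj n ◁ tensEndo (F := fun a => P.obj a ⊗ tpow X a)
        (fun a j => P.obj a ◁ tpowSwap X j a) js k ≫ opComp P X k ≫ schurι P X k.sum := by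
  obtain ⟨g, hg, e⟩ := tensEndo_swap_unzip P X js k
  have h := P.comp_act_inner (swapEquiv js k)
  simp only [opComp, Category.assoc]
  rw [← whiskerLeft_comp_assoc, ← whiskerLeft_comp_assoc, e, tensEndo_act_unzip,
    whiskerLeft_comp_assoc, whiskerLeft_comp_assoc, associator_inv_naturality_middle_assoc,
    associator_inv_naturality_right_assoc, ← comp_whiskerRight_assoc, h, comp_whiskerRight_assoc,
    schurι_realizes P hg, whisker_exchange_assoc]

theorem opComp_outer (X : C) {n : ℕ} (j : ℕ) (k : Vec ℕ n) :
    P.act (swapPerm j n) ▷ _ ≫ opComp P X k ≫ schurι P X k.sum =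
      P.obj n ◁ tensSwap (fun a => P.obj a ⊗ tpow X a) j k ≫
        opComp P X (k.swapAt j) ≫ schurι P X (k.swapAt j).sum := by
  obtain ⟨g, hg, e⟩ := tensSwap_unzip P X j k
  have h := P.comp_act_outer j k
  simp only [opComp, Category.assoc]
  rw [← whiskerLeft_comp_assoc, e, whiskerLeft_comp_assoc, MonoidalCategory.tensorHom_def,
    whiskerLeft_comp_assoc, associator_inv_naturality_right_assoc,
    associator_inv_naturality_middle_assoc, ← whisker_exchange_assoc,
    associator_inv_naturality_left_assoc, ← comp_whiskerRight_assoc, h]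
  simp only [comp_whiskerRight, Category.assoc]
  rw [schurι_realizes P hg, whisker_exchange_assoc]


variable [MonoidalClosed C]

theorem schur_tensor_desc (X L Z : C) (ψ : ∀ a, L ⊗ (P.obj a ⊗ tpow X a) ⟶ Z)
    (h : ∀ a j, L ◁ (P.act (swapPerm j a) ▷ tpow X a) ≫ ψ a =
      L ◁ (P.obj a ◁ tpowSwap X j a) ≫ ψ a) :
    ∃! m : L ⊗ schur P X ⟶ Z, ∀ a, L ◁ schurι P X a ≫ m = ψ a := by
  refine ⟨MonoidalClosed.uncurry (schurDesc P (fun a => MonoidalClosed.curry (ψ a)) ?_), ?_, ?_⟩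
  · intro a j
    rw [← MonoidalClosed.curry_natural_left, h, MonoidalClosed.curry_natural_left]
  · intro a
    rw [← MonoidalClosed.uncurry_natural_left, schurι_desc, MonoidalClosed.uncurry_curry]
  · intro m hm
    rw [← MonoidalClosed.curry_eq_iff]
    refine schur_hom_ext P fun a => ?_
    rw [← MonoidalClosed.curry_natural_left, hm, schurι_desc]

/-- Morphisms out of `L ⊗ P(X)^{⊗ n}` are described by families of morphisms out of
`L ⊗ ⨂ᵢ (P kᵢ ⊗ X^{⊗ kᵢ})`. -/
theorem schur_pow_desc (X L Z : C) {n : ℕ}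
    (φ : ∀ k : Vec ℕ n, L ⊗ tens (fun a => P.obj a ⊗ tpow X a) k ⟶ Z)
    (h : ∀ js k : Vec ℕ n, L ◁ tensEndo (F := fun a => P.obj a ⊗ tpow X a)
        (fun a j => P.act (swapPerm j a) ▷ tpow X a) js k ≫ φ k =
      L ◁ tensEndo (F := fun a => P.obj a ⊗ tpow X a)
        (fun a j => P.obj a ◁ tpowSwap X j a) js k ≫ φ k) :
    ∃! m : L ⊗ tpow (schur P X) n ⟶ Z, ∀ k, L ◁ tensToPow (schurι P X) k ≫ m = φ k := by
  refine tens_desc (F := fun a => P.obj a ⊗ tpow X a) _ _ (schurι P X) ?_ ?_ ?_ ?_ n L Z φ h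
  · intro a
    simp only [swapPerm_eq_refl a a (by omega), P.act_refl, id_whiskerRight]
  · intro a
    simp only [tpowSwap_eq_id X a a (by omega), whiskerLeft_id]
  · intro a j
    exact schurι_condition P X a j
  · intro L Z ψ hψ
    exact schur_tensor_desc P X L Z ψ hψ

theorem schur_pow_hom_ext {X L Z : C} {n : ℕ} {f g : L ⊗ tpow (schur P X) n ⟶ Z}
    (h : ∀ k : Vec ℕ n, L ◁ tensToPow (schurι P X) k ≫ f = L ◁ tensToPow (schurι P X) k ≫ g) :
    f = g := by
  refine (schur_pow_desc P X L Z (fun k => L ◁ tensToPow (schurι P X) k ≫ g) ?_).unique h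
    (fun k => rfl)
  intro js k
  rw [← whiskerLeft_comp_assoc, tensEndo_toPow _ _ _ (fun a j => schurι_condition P X a j),
    whiskerLeft_comp_assoc]

/-- The multiplication on the summand `P n ⊗ P(X)^{⊗ n}`: the unique morphism that is given on
`P n ⊗ ⨂ᵢ (P kᵢ ⊗ X^{⊗ kᵢ})` by the composition of the operad. -/
theorem schurMulAux_existsUnique (X : C) (n : ℕ) :
    ∃! m : P.obj n ⊗ tpow (schur P X) n ⟶ schur P X, ∀ k : Vec ℕ n,
      P.obj n ◁ tensToPow (schurι P X) k ≫ m = opComp P X k ≫ schurι P X k.sum :=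
  schur_pow_desc P X _ _ _ fun js k => opComp_inner P X js k

/-- The multiplication on the summand `P n ⊗ P(X)^{⊗ n}`. -/
def schurMulAux (X : C) (n : ℕ) : P.obj n ⊗ tpow (schur P X) n ⟶ schur P X :=
  (schurMulAux_existsUnique P X n).choose

theorem schurMulAux_spec (X : C) {n : ℕ} (k : Vec ℕ n) :
    P.obj n ◁ tensToPow (schurι P X) k ≫ schurMulAux P X n = opComp P X k ≫ schurι P X k.sum :=
  (schurMulAux_existsUnique P X n).choose_spec.1 k

/-- The multiplication `μ : P(P(X)) → P(X)` of the Schur functor, induced by the composition of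
the operad. -/
def schurMul (X : C) : schur P (schur P X) ⟶ schur P X :=
  schurDesc P (schurMulAux P X) (by
    intro n j
    refine schur_pow_hom_ext P fun k => ?_
    rw [whisker_exchange_assoc, schurMulAux_spec, opComp_outer, ← whiskerLeft_comp_assoc,
      tensToPow_swap, whiskerLeft_comp_assoc, schurMulAux_spec])

/-- The multiplication is characterized by the composition of the operad. -/
theorem schurMul_spec (X : C) {n : ℕ} (k : Vec ℕ n) :
    P.obj n ◁ tensToPow (schurι P X) k ≫ schurι P (schur P X) n ≫ schurMul P X =
      opComp P X k ≫ schurι P X k.sum := by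
  rw [schurMul, schurι_desc, schurMulAux_spec]

/-- The unit `X → P(X)` of the Schur functor, induced by the unit of the operad. -/
def schurOne (X : C) : X ⟶ schur P X :=
  (λ_ X).inv ≫ (P.one ⊗ₘ (λ_ X).inv) ≫ schurι P X 1

end Multiplication

end Schur

/-! ### The object `P ∘ (B|X)` -/

section RelPow

variable {C : Type u} [Category.{v} C] [Abelian C] [MonoidalCategory C]

theorem whiskerLeft_zero_of_closed [MonoidalClosed C] (L V W : C) : L ◁ (0 : V ⟶ W) = 0 := by
  apply MonoidalClosed.curry_injective
  have h : ∀ Z : C, MonoidalClosed.curry (L ◁ (0 : V ⟶ W) ≫ (0 : L ⊗ W ⟶ Z)) = 0 := fun Z => by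
    rw [MonoidalClosed.curry_natural_left, zero_comp]
  have h' := h (L ⊗ W)
  rw [comp_zero] at h'
  rw [h', ← Category.comp_id (L ◁ (0 : V ⟶ W)), MonoidalClosed.curry_natural_left, zero_comp]

/-- The quotient `(X ⊕ B)^{⊗ n} / B^{⊗ n}`. -/
def relPow (B X : C) (n : ℕ) : C :=
  cokernel (tpowMap (biprod.inr : B ⟶ X ⊞ B) n)

/-- The quotient morphism `(X ⊕ B)^{⊗ n} → (X ⊕ B)^{⊗ n} / B^{⊗ n}`. -/
def relPowProj (B X : C) (n : ℕ) : tpow (X ⊞ B) n ⟶ relPow B X n :=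
  cokernel.π _

theorem relPow_hom_ext {B X Z : C} {n : ℕ} {f g : relPow B X n ⟶ Z}
    (h : relPowProj B X n ≫ f = relPowProj B X n ≫ g) : f = g :=
  coequalizer.hom_ext h

/-- Functoriality of `(X ⊕ B)^{⊗ n} / B^{⊗ n}`. -/
def relPowMap {B B' X X' : C} (g : B ⟶ B') (f : X ⟶ X') (n : ℕ) :
    relPow B X n ⟶ relPow B' X' n :=
  cokernel.map _ _ (tpowMap g n) (tpowMap (biprod.map f g) n) (by
    rw [← tpowMap_comp, ← tpowMap_comp, biprod.inr_map])

theorem relPowProj_map {B B' X X' : C} (g : B ⟶ B') (f : X ⟶ X') (n : ℕ) :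
    relPowProj B X n ≫ relPowMap g f n = tpowMap (biprod.map f g) n ≫ relPowProj B' X' n :=
  cokernel.π_desc _ _ _

theorem relPowMap_id (B X : C) (n : ℕ) : relPowMap (𝟙 B) (𝟙 X) n = 𝟙 _ := by
  have h : biprod.map (𝟙 X) (𝟙 B) = 𝟙 (X ⊞ B) := by ext <;> simp
  refine relPow_hom_ext ?_
  rw [relPowProj_map, h, tpowMap_id, Category.id_comp, Category.comp_id]

theorem relPowMap_comp {B B' B'' X X' X'' : C} (g : B ⟶ B') (g' : B' ⟶ B'') (f : X ⟶ X')
    (f' : X' ⟶ X'') (n : ℕ) :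
    relPowMap (g ≫ g') (f ≫ f') n = relPowMap g f n ≫ relPowMap g' f' n := by
  have h : biprod.map (f ≫ f') (g ≫ g') = biprod.map f g ≫ biprod.map f' g' := by ext <;> simp
  refine relPow_hom_ext ?_
  rw [relPowProj_map, h, tpowMap_comp, ← Category.assoc, relPowProj_map, Category.assoc,
    Category.assoc, relPowProj_map]

/-- The inclusion of `(X ⊕ B)^{⊗ n} / B^{⊗ n}` into `(X ⊕ B)^{⊗ n}` as the complement of
`B^{⊗ n}`, i.e. as the kernel of the projection to `B^{⊗ n}`. -/
def relPowIncl (B X : C) (n : ℕ) : relPow B X n ⟶ tpow (X ⊞ B) n :=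
  cokernel.desc _ (𝟙 _ - tpowMap (biprod.snd ≫ biprod.inr) n) (by
    rw [Preadditive.comp_sub, ← tpowMap_comp, biprod.inr_snd_assoc, Category.comp_id, sub_self])

theorem relPowProj_incl (B X : C) (n : ℕ) :
    relPowProj B X n ≫ relPowIncl B X n = 𝟙 _ - tpowMap (biprod.snd ≫ biprod.inr) n :=
  cokernel.π_desc _ _ _

theorem relPowIncl_natural {B B' X X' : C} (g : B ⟶ B') (f : X ⟶ X') (n : ℕ) :
    relPowMap g f n ≫ relPowIncl B' X' n = relPowIncl B X n ≫ tpowMap (biprod.map f g) n := by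
  refine relPow_hom_ext ?_
  rw [← Category.assoc, relPowProj_map, Category.assoc, relPowProj_incl, ← Category.assoc,
    relPowProj_incl, Preadditive.sub_comp, Preadditive.comp_sub, ← tpowMap_comp, ← tpowMap_comp,
    Category.comp_id, Category.id_comp, biprod.map_snd_assoc, Category.assoc, biprod.inr_map]

theorem relPowIncl_snd (B X : C) (n : ℕ) :
    relPowIncl B X n ≫ tpowMap (biprod.snd : X ⊞ B ⟶ B) n = 0 := by
  refine relPow_hom_ext ?_
  rw [← Category.assoc, relPowProj_incl, Preadditive.sub_comp, ← tpowMap_comp, Category.assoc,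
    biprod.inr_snd, Category.comp_id, Category.id_comp, sub_self, comp_zero]

variable [SymmetricCategory C]

/-- The action of the adjacent transposition `swapPerm j n` on `(X ⊕ B)^{⊗ n} / B^{⊗ n}`. -/
def relPowSwap (B X : C) (n j : ℕ) : relPow B X n ⟶ relPow B X n :=
  cokernel.map _ _ (tpowSwap B j n) (tpowSwap (X ⊞ B) j n) (tpowSwap_natural _ j n)

theorem relPowProj_swap (B X : C) (n j : ℕ) :
    relPowProj B X n ≫ relPowSwap B X n j = tpowSwap (X ⊞ B) j n ≫ relPowProj B X n :=
  cokernel.π_desc _ _ _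

theorem relPowMap_swap {B B' X X' : C} (g : B ⟶ B') (f : X ⟶ X') (n j : ℕ) :
    relPowMap g f n ≫ relPowSwap B' X' n j = relPowSwap B X n j ≫ relPowMap g f n := by
  refine relPow_hom_ext ?_
  rw [← Category.assoc, relPowProj_map, Category.assoc, relPowProj_swap, ← Category.assoc,
    tpowSwap_natural, Category.assoc, ← Category.assoc (relPowProj B X n), relPowProj_swap,
    Category.assoc, relPowProj_map]

theorem relPowIncl_swap (B X : C) (n j : ℕ) :
    relPowIncl B X n ≫ tpowSwap (X ⊞ B) j n = relPowSwap B X n j ≫ relPowIncl B X n := by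
  refine relPow_hom_ext ?_
  rw [← Category.assoc, relPowProj_incl, ← Category.assoc, relPowProj_swap, Category.assoc,
    relPowProj_incl, Preadditive.sub_comp, Preadditive.comp_sub, tpowSwap_natural,
    Category.id_comp, Category.comp_id]

end RelPow

section Algebras

variable {C : Type u} [Category.{v} C] [Abelian C] [HasCoproducts.{0} C] [MonoidalCategory C]
  [SymmetricCategory C] (P : SymmOperad C)

theorem schurIn_map {X Y : C} (f : X ⟶ Y) (n : ℕ) :
    schurIn P X n ≫ schurMap P f =
      coinvMap P (tpowMap f n) (fun j => tpowSwap_natural f j n) ≫ schurIn P Y n :=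
  Sigma.ι_map _ _

theorem schurι_map {X Y : C} (f : X ⟶ Y) (n : ℕ) :
    schurι P X n ≫ schurMap P f = P.obj n ◁ tpowMap f n ≫ schurι P Y n := by
  rw [schurι, Category.assoc, schurIn_map, coinvMk_map_assoc, schurι]

theorem schurMap_id (X : C) : schurMap P (𝟙 X) = 𝟙 _ := by
  refine schur_hom_ext P fun n => ?_
  rw [schurι_map, tpowMap_id, whiskerLeft_id, Category.id_comp, Category.comp_id]

theorem schurMap_comp {X Y Z : C} (f : X ⟶ Y) (g : Y ⟶ Z) :
    schurMap P (f ≫ g) = schurMap P f ≫ schurMap P g := by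
  refine schur_hom_ext P fun n => ?_
  rw [schurι_map, tpowMap_comp, whiskerLeft_comp_assoc, ← Category.assoc (schurι P X n),
    schurι_map, Category.assoc, schurι_map]

/-- `P ∘ (B|X) = ⨁ₙ P n ⊗_{Σₙ} ((X ⊕ B)^{⊗ n} / B^{⊗ n})`. -/
def schurRel (B X : C) : C :=
  ∐ fun n : ℕ => coinv P n (relPow B X n) (relPowSwap B X n)

/-- The inclusion of the `n`-th summand. -/
def schurRelIn (B X : C) (n : ℕ) : coinv P n (relPow B X n) (relPowSwap B X n) ⟶ schurRel P B X :=
  Sigma.ι (fun n : ℕ => coinv P n (relPow B X n) (relPowSwap B X n)) n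

/-- The canonical morphism `P n ⊗ ((X ⊕ B)^{⊗ n} / B^{⊗ n}) → P ∘ (B|X)`. -/
def schurRelι (B X : C) (n : ℕ) : P.obj n ⊗ relPow B X n ⟶ schurRel P B X :=
  coinvMk P n (relPow B X n) (relPowSwap B X n) ≫ schurRelIn P B X n

theorem schurRel_hom_ext {B X Z : C} {f g : schurRel P B X ⟶ Z}
    (h : ∀ n, schurRelι P B X n ≫ f = schurRelι P B X n ≫ g) : f = g := by
  refine Sigma.hom_ext _ _ fun n => coinv_hom_ext P ?_
  have := h n
  rw [schurRelι, Category.assoc, Category.assoc] at this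
  exact this

/-- Functoriality of `P ∘ (B|X)`: the morphism `P ∘ (g|f)`. -/
def schurRelMap {B B' X X' : C} (g : B ⟶ B') (f : X ⟶ X') : schurRel P B X ⟶ schurRel P B' X' :=
  Limits.Sigma.map fun n : ℕ => coinvMap P (relPowMap g f n) (relPowMap_swap g f n)

/-- The projection `P(X ⊕ B) → P ∘ (B|X)`. -/
def relProj (B X : C) : schur P (X ⊞ B) ⟶ schurRel P B X :=
  Limits.Sigma.map fun n : ℕ => coinvMap P (relPowProj B X n) (relPowProj_swap B X n)

/-- The inclusion `P ∘ (B|X) → P(X ⊕ B)` of the complement of the summand `P(B)`. -/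
def relIncl (B X : C) : schurRel P B X ⟶ schur P (X ⊞ B) :=
  Limits.Sigma.map fun n : ℕ => coinvMap P (relPowIncl B X n) (relPowIncl_swap B X n)

theorem schurRelι_map {B B' X X' : C} (g : B ⟶ B') (f : X ⟶ X') (n : ℕ) :
    schurRelι P B X n ≫ schurRelMap P g f = P.obj n ◁ relPowMap g f n ≫ schurRelι P B' X' n := by
  have h : schurRelIn P B X n ≫ schurRelMap P g f =
      coinvMap P (relPowMap g f n) (relPowMap_swap g f n) ≫ schurRelIn P B' X' n :=
    Sigma.ι_map _ _
  rw [schurRelι, Category.assoc, h, coinvMk_map_assoc, schurRelι]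

theorem schurι_proj (B X : C) (n : ℕ) :
    schurι P (X ⊞ B) n ≫ relProj P B X = P.obj n ◁ relPowProj B X n ≫ schurRelι P B X n := by
  have h : schurIn P (X ⊞ B) n ≫ relProj P B X =
      coinvMap P (relPowProj B X n) (relPowProj_swap B X n) ≫ schurRelIn P B X n :=
    Sigma.ι_map _ _
  rw [schurι, Category.assoc, h, coinvMk_map_assoc, schurRelι]

theorem schurRelι_incl (B X : C) (n : ℕ) :
    schurRelι P B X n ≫ relIncl P B X = P.obj n ◁ relPowIncl B X n ≫ schurι P (X ⊞ B) n := by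
  have h : schurRelIn P B X n ≫ relIncl P B X =
      coinvMap P (relPowIncl B X n) (relPowIncl_swap B X n) ≫ schurIn P (X ⊞ B) n :=
    Sigma.ι_map _ _
  rw [schurRelι, Category.assoc, h, coinvMk_map_assoc, schurι]

theorem schurRelMap_id (B X : C) : schurRelMap P (𝟙 B) (𝟙 X) = 𝟙 _ := by
  refine schurRel_hom_ext P fun n => ?_
  rw [schurRelι_map, relPowMap_id, whiskerLeft_id, Category.id_comp, Category.comp_id]

theorem schurRelMap_comp {B B' B'' X X' X'' : C} (g : B ⟶ B') (g' : B' ⟶ B'') (f : X ⟶ X')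
    (f' : X' ⟶ X'') :
    schurRelMap P (g ≫ g') (f ≫ f') = schurRelMap P g f ≫ schurRelMap P g' f' := by
  refine schurRel_hom_ext P fun n => ?_
  rw [schurRelι_map, relPowMap_comp, whiskerLeft_comp_assoc,
    ← Category.assoc (schurRelι P B X n), schurRelι_map, Category.assoc, schurRelι_map]

theorem relProj_natural {B B' X X' : C} (g : B ⟶ B') (f : X ⟶ X') :
    relProj P B X ≫ schurRelMap P g f = schurMap P (biprod.map f g) ≫ relProj P B' X' := by
  refine schur_hom_ext P fun n => ?_
  rw [← Category.assoc, schurι_proj, Category.assoc, schurRelι_map, ← Category.assoc (schurι P _ n),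
    schurι_map, Category.assoc, schurι_proj, ← whiskerLeft_comp_assoc, ← whiskerLeft_comp_assoc,
    relPowProj_map]

theorem relIncl_natural {B B' X X' : C} (g : B ⟶ B') (f : X ⟶ X') :
    schurRelMap P g f ≫ relIncl P B' X' = relIncl P B X ≫ schurMap P (biprod.map f g) := by
  refine schurRel_hom_ext P fun n => ?_
  rw [← Category.assoc, schurRelι_map, Category.assoc, schurRelι_incl,
    ← Category.assoc (schurRelι P _ _ n), schurRelι_incl, Category.assoc, schurι_map,
    ← whiskerLeft_comp_assoc, ← whiskerLeft_comp_assoc, relPowIncl_natural]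

variable [MonoidalClosed C]

theorem relIncl_snd (B X : C) : relIncl P B X ≫ schurMap P (biprod.snd : X ⊞ B ⟶ B) = 0 := by
  refine schurRel_hom_ext P fun n => ?_
  rw [← Category.assoc, schurRelι_incl, Category.assoc, schurι_map, ← whiskerLeft_comp_assoc,
    relPowIncl_snd, whiskerLeft_zero_of_closed, zero_comp, comp_zero]

/-- The restriction `P ∘ (P(B)|P ∘ (B|X)) → P ∘ (B|X)` of the multiplication
`P(P(X ⊕ B)) → P(X ⊕ B)` to the indicated summands, where `P(X ⊕ B)` is identified with
`P ∘ (B|X) ⊕ P(B)`. -/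
def relMul (B X : C) : schurRel P (schur P B) (schurRel P B X) ⟶ schurRel P B X :=
  relIncl P (schur P B) (schurRel P B X) ≫
    schurMap P (biprod.desc (relIncl P B X) (schurMap P biprod.inr)) ≫
      schurMul P (X ⊞ B) ≫ relProj P B X

/-- Algebras over the operad `P`: algebras over the monad `P(-)`. -/
structure PAlg (P : SymmOperad C) where
  /-- the underlying object -/
  carrier : C
  /-- the structure morphism -/
  str : schur P carrier ⟶ carrier
  unit : schurOne P carrier ≫ str = 𝟙 carrier
  assoc : schurMap P str ≫ str = schurMul P carrier ≫ str

/-- Morphisms of algebras. -/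
@[ext]
structure PAlg.Hom {P : SymmOperad C} (A B : PAlg P) where
  /-- the underlying morphism -/
  hom : A.carrier ⟶ B.carrier
  comm : schurMap P hom ≫ B.str = A.str ≫ hom

/-- The category of algebras over `P`. -/
instance (P : SymmOperad C) : Category (PAlg P) where
  Hom := PAlg.Hom
  id A := ⟨𝟙 _, by rw [schurMap_id, Category.id_comp, Category.comp_id]⟩
  comp f g := ⟨f.hom ≫ g.hom, by
    rw [schurMap_comp, Category.assoc, g.comm, ← Category.assoc, f.comm, Category.assoc]⟩
  id_comp _ := PAlg.Hom.ext (Category.id_comp _)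
  comp_id _ := PAlg.Hom.ext (Category.comp_id _)
  assoc _ _ _ := PAlg.Hom.ext (Category.assoc _ _ _)

/-- The morphism `ρ : P ∘ (B|X) → X` is an internal action of the algebra `B` on the
algebra `X`. -/
structure IsInternalAction {P : SymmOperad C} (B X : PAlg P)
    (ρ : schurRel P B.carrier X.carrier ⟶ X.carrier) : Prop where
  /-- compatibility with the structure morphism of `X` -/
  compat : (schurMap P biprod.inl ≫ relProj P B.carrier X.carrier) ≫ ρ = X.str
  /-- associativity of the action -/
  assoc : relMul P B.carrier X.carrier ≫ ρ = schurRelMap P B.str ρ ≫ ρ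

/-- Triples `(B, X, ρ)`, where `ρ` is an internal action of the algebra `B` on the algebra `X`. -/
structure Act (P : SymmOperad C) where
  /-- the acting algebra -/
  B : PAlg P
  /-- the algebra that is acted upon -/
  X : PAlg P
  /-- the action -/
  ρ : schurRel P B.carrier X.carrier ⟶ X.carrier
  isAction : IsInternalAction B X ρ

/-- Morphisms of internal actions. -/
@[ext]
structure Act.Hom {P : SymmOperad C} (S T : Act P) where
  /-- the morphism between the acting algebras -/
  g : S.B ⟶ T.B
  /-- the morphism between the algebras that are acted upon -/
  f : S.X ⟶ T.X
  comm : schurRelMap P g.hom f.hom ≫ T.ρ = S.ρ ≫ f.hom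

/-- The category of internal actions. -/
instance (P : SymmOperad C) : Category (Act P) where
  Hom := Act.Hom
  id S := ⟨𝟙 _, 𝟙 _, by
    change schurRelMap P (𝟙 _) (𝟙 _) ≫ S.ρ = S.ρ ≫ 𝟙 _
    rw [schurRelMap_id, Category.id_comp, Category.comp_id]⟩
  comp a b := ⟨a.g ≫ b.g, a.f ≫ b.f, by
    change schurRelMap P (a.g.hom ≫ b.g.hom) (a.f.hom ≫ b.f.hom) ≫ _ = _ ≫ a.f.hom ≫ b.f.hom
    rw [schurRelMap_comp, Category.assoc, b.comm, ← Category.assoc, a.comm, Category.assoc]⟩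
  id_comp _ := Act.Hom.ext (Category.id_comp _) (Category.id_comp _)
  comp_id _ := Act.Hom.ext (Category.comp_id _) (Category.comp_id _)
  assoc _ _ _ := Act.Hom.ext (Category.assoc _ _ _) (Category.assoc _ _ _)

/-- Split short exact sequences `0 → X → E → B → 0` of algebras, with a section `s : B → E`;
exactness is exactness of the underlying sequence in `C`. -/
structure SplitExt (P : SymmOperad C) where
  /-- the kernel -/
  X : PAlg P
  /-- the middle term -/
  E : PAlg P
  /-- the quotient -/
  B : PAlg P
  /-- the inclusion of the kernel -/
  i : X ⟶ E
  /-- the quotient morphism -/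
  p : E ⟶ B
  /-- the section -/
  s : B ⟶ E
  section_comp : s ≫ p = 𝟙 B
  zero : i.hom ≫ p.hom = 0
  exact : (ShortComplex.mk i.hom p.hom zero).ShortExact

/-- Morphisms of split short exact sequences. -/
@[ext]
structure SplitExt.Hom {P : SymmOperad C} (S T : SplitExt P) where
  /-- the morphism between the kernels -/
  f : S.X ⟶ T.X
  /-- the morphism between the middle terms -/
  h : S.E ⟶ T.E
  /-- the morphism between the quotients -/
  g : S.B ⟶ T.B
  comm_i : S.i ≫ h = f ≫ T.i
  comm_p : S.p ≫ g = h ≫ T.p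
  comm_s : S.s ≫ h = g ≫ T.s

/-- The category of split short exact sequences of algebras. -/
instance (P : SymmOperad C) : Category (SplitExt P) where
  Hom := SplitExt.Hom
  id S := ⟨𝟙 _, 𝟙 _, 𝟙 _, by simp, by simp, by simp⟩
  comp a b := ⟨a.f ≫ b.f, a.h ≫ b.h, a.g ≫ b.g,
    by rw [← Category.assoc, a.comm_i, Category.assoc, b.comm_i, Category.assoc],
    by rw [← Category.assoc, a.comm_p, Category.assoc, b.comm_p, Category.assoc],
    by rw [← Category.assoc, a.comm_s, Category.assoc, b.comm_s, Category.assoc]⟩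
  id_comp _ := SplitExt.Hom.ext (Category.id_comp _) (Category.id_comp _) (Category.id_comp _)
  comp_id _ := SplitExt.Hom.ext (Category.comp_id _) (Category.comp_id _) (Category.comp_id _)
  assoc _ _ _ := SplitExt.Hom.ext (Category.assoc _ _ _) (Category.assoc _ _ _)
    (Category.assoc _ _ _)

/-! ### From actions to split short exact sequences -/

/-- The structure morphism of the semidirect product, given by the matrix with diagonal entries
`ρ` and the structure morphism of `B`:
`P(X ⊕ B) = P ∘ (B|X) ⊕ P(B) → X ⊕ B`. -/
def Act.semidirectStr {P : SymmOperad C} (S : Act P) :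
    schur P (S.X.carrier ⊞ S.B.carrier) ⟶ S.X.carrier ⊞ S.B.carrier :=
  biprod.lift (relProj P _ _ ≫ S.ρ) (schurMap P biprod.snd ≫ S.B.str)

/-- `X ⊕ B`, with the above structure morphism, is an algebra, and the canonical morphisms
`X → X ⊕ B` and `B → X ⊕ B` are morphisms of algebras. -/
structure Act.IsSemidirect {P : SymmOperad C} (S : Act P) : Prop where
  unit : schurOne P _ ≫ S.semidirectStr = 𝟙 _
  assoc : schurMap P S.semidirectStr ≫ S.semidirectStr = schurMul P _ ≫ S.semidirectStr
  inl_comm : schurMap P biprod.inl ≫ S.semidirectStr = S.X.str ≫ biprod.inl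
  inr_comm : schurMap P biprod.inr ≫ S.semidirectStr = S.B.str ≫ biprod.inr

/-- The split short exact sequence `0 → X → X ⊕ B → B → 0` given by an action. -/
def Act.toSplitExt {P : SymmOperad C} (S : Act P) (hS : S.IsSemidirect) : SplitExt P where
  X := S.X
  E := ⟨S.X.carrier ⊞ S.B.carrier, S.semidirectStr, hS.unit, hS.assoc⟩
  B := S.B
  i := ⟨biprod.inl, hS.inl_comm⟩
  p := ⟨biprod.snd, (biprod.lift_snd _ _).symm⟩
  s := ⟨biprod.inr, hS.inr_comm⟩
  section_comp := PAlg.Hom.ext biprod.inr_snd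
  zero := biprod.inl_snd
  exact := (ShortComplex.Splitting.ofHasBinaryBiproduct _ _).shortExact

/-- The functor from actions to split short exact sequences, given on a morphism `(g, f)` by `f`,
`f ⊕ g` and `g`. -/
def actToSplitExt (P : SymmOperad C) (h : ∀ S : Act P, S.IsSemidirect) : Act P ⥤ SplitExt P where
  obj S := S.toSplitExt (h S)
  map {S T} a :=
    { f := a.f
      h := ⟨biprod.map a.f.hom a.g.hom, by
        change schurMap P _ ≫ T.semidirectStr = S.semidirectStr ≫ _
        apply biprod.hom_ext
        · simp only [Act.semidirectStr, Category.assoc, biprod.lift_fst, biprod.map_fst,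
            biprod.lift_fst_assoc]
          rw [← a.comm, ← Category.assoc, ← relProj_natural, Category.assoc]
        · simp only [Act.semidirectStr, Category.assoc, biprod.lift_snd, biprod.map_snd,
            biprod.lift_snd_assoc]
          rw [← a.g.comm, ← Category.assoc, ← schurMap_comp, biprod.map_snd, schurMap_comp,
            Category.assoc]⟩
      g := a.g
      comm_i := PAlg.Hom.ext (biprod.inl_map _ _)
      comm_p := PAlg.Hom.ext (biprod.map_snd _ _).symm
      comm_s := PAlg.Hom.ext (biprod.inr_map _ _) }
  map_id S := SplitExt.Hom.ext rfl (PAlg.Hom.ext (by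
    change biprod.map (𝟙 S.X.carrier) (𝟙 S.B.carrier) = 𝟙 _
    ext <;> simp)) rfl
  map_comp a b := SplitExt.Hom.ext rfl (PAlg.Hom.ext (by
    change biprod.map (a.f.hom ≫ b.f.hom) (a.g.hom ≫ b.g.hom) = biprod.map _ _ ≫ biprod.map _ _
    ext <;> simp)) rfl

/-! ### From split short exact sequences to actions -/

/-- The restriction to `P ∘ (B|X)` of the morphism `P(X ⊕ B) → P(E) → E` given by the inclusion
of `X`, the section of `B` and the structure morphism of `E`. -/
def SplitExt.preAction {P : SymmOperad C} (S : SplitExt P) :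
    schurRel P S.B.carrier S.X.carrier ⟶ S.E.carrier :=
  relIncl P _ _ ≫ schurMap P (biprod.desc S.i.hom S.s.hom) ≫ S.E.str

theorem SplitExt.preAction_comp {P : SymmOperad C} (S : SplitExt P) :
    S.preAction ≫ S.p.hom = 0 := by
  have h : biprod.desc S.i.hom S.s.hom ≫ S.p.hom = biprod.snd := by
    have := congrArg PAlg.Hom.hom S.section_comp
    apply biprod.hom_ext'
    · rw [biprod.inl_desc_assoc, S.zero, biprod.inl_snd]
    · rw [biprod.inr_desc_assoc, biprod.inr_snd]; exact this
  rw [preAction, Category.assoc, Category.assoc, ← S.p.comm, ← Category.assoc (schurMap P _),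
    ← schurMap_comp, h, ← Category.assoc, relIncl_snd, zero_comp]

/-- The morphism `ρ : P ∘ (B|X) → X` induced by a split short exact sequence: the unique one whose
composite with the inclusion `X → E` is the restriction of the structure morphism of `E`. -/
def SplitExt.ρ {P : SymmOperad C} (S : SplitExt P) :
    schurRel P S.B.carrier S.X.carrier ⟶ S.X.carrier :=
  haveI := S.exact.mono_f
  S.exact.exact.lift S.preAction S.preAction_comp

theorem SplitExt.ρ_comp {P : SymmOperad C} (S : SplitExt P) :
    S.ρ ≫ S.i.hom = S.preAction :=
  haveI := S.exact.mono_f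
  S.exact.exact.lift_f S.preAction S.preAction_comp

/-- The functor from split short exact sequences to actions, given on a morphism `(f, h, g)` by
`(g, f)`. -/
def splitExtToAct (P : SymmOperad C) (h : ∀ S : SplitExt P, IsInternalAction S.B S.X S.ρ) :
    SplitExt P ⥤ Act P where
  obj S := ⟨S.B, S.X, S.ρ, h S⟩
  map {S T} a :=
    { g := a.g
      f := a.f
      comm := by
        have := T.exact.mono_f
        have hi := congrArg PAlg.Hom.hom a.comm_i
        have hs := congrArg PAlg.Hom.hom a.comm_s
        change S.i.hom ≫ a.h.hom = a.f.hom ≫ T.i.hom at hi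
        change S.s.hom ≫ a.h.hom = a.g.hom ≫ T.s.hom at hs
        have hm : biprod.map a.f.hom a.g.hom ≫ biprod.desc T.i.hom T.s.hom =
            biprod.desc S.i.hom S.s.hom ≫ a.h.hom := by
          apply biprod.hom_ext' <;> simp [hi, hs]
        refine (cancel_mono (f := (ShortComplex.mk T.i.hom T.p.hom T.zero).f)).1 ?_
        change (schurRelMap P a.g.hom a.f.hom ≫ T.ρ) ≫ T.i.hom = (S.ρ ≫ a.f.hom) ≫ T.i.hom
        rw [Category.assoc, Category.assoc, T.ρ_comp, ← hi, ← Category.assoc, S.ρ_comp,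
          SplitExt.preAction, SplitExt.preAction, ← Category.assoc, relIncl_natural,
          Category.assoc, ← Category.assoc (schurMap P _), ← schurMap_comp, hm, schurMap_comp,
          Category.assoc, Category.assoc, Category.assoc, a.h.comm] }
  map_id _ := rfl
  map_comp _ _ := rfl

end Algebras

end OperadAction

end

/-! Everything rests on the decomposition of `P(X ⊕ B)` as `P ∘ (B|X) ⊕ P(B)`. The projection
`relProj` followed by the inclusion `relIncl` is the identity minus the idempotent `P(inr ∘ snd)`
(`relProj_relIncl`). As `relProj` is an epimorphism that kills `P(inr)`, the other identities of a
direct sum follow, and `relSum` is the resulting map from the sum to `P(X ⊕ B)`. This uses that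
tensoring with a fixed object is additive, which holds because it is a left adjoint.

The multiplication of the monad respects the decomposition. Since it is natural
(`schurMul_natural`), it commutes with `inr` and `snd`. Hence after projection to `P ∘ (B|X)` it
depends only on the summand `P ∘ (P(B)|P ∘ (B|X))` of the source (`relProj_relMul`), and on that
summand it takes values in `P ∘ (B|X)` (`relMul_relIncl`).

For an action, the structure morphism on `X ⊕ B` is therefore diagonal, and its associativity splits
into two components: over `X` it is the associativity axiom of the action, over `B` it is the
associativity of `B`. Conversely, for a split sequence the map `(i, s) : X ⊕ B → E` carries the
diagonal morphism with entries `ρ` and the structure of `B` to the structure of `E`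
(`SplitExt.relSum_desc`). As `i` is a monomorphism, the axioms of an action can be checked in `E`,
where they become the associativity of `E` and the fact that `i` is a morphism of algebras.

Reducedness enters through `P 0 = 0`, which gives `P(0) = 0` (`schurMap_zero`). Without constants,
`P(X) → P(X ⊕ B) → P(B)` vanishes, so `P(X)` lies in the summand `P ∘ (B|X)`.

In the equivalence, the round trip on actions returns the same `ρ`, and the round trip on split
sequences is compared with the identity by `(i, s)`, an isomorphism by the splitting of the
underlying sequence. -/

noncomputable section

namespace OperadAction

/-! ### Naturality in `X` of the rearrangements of tensor powers and of the operadic composition. -/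

section Naturality

variable {C : Type u} [Category.{v} C] [MonoidalCategory C]

/-- The tensor product of morphisms `F a ⟶ G a` over the entries of a sequence. -/
def tensHom {α : Type*} {F G : α → C} (φ : ∀ a, F a ⟶ G a) :
    {n : ℕ} → (v : Vec α n) → (tens F v ⟶ tens G v)
  | _, .nil => 𝟙 _
  | _, .snoc v a => tensHom φ v ⊗ₘ φ a

theorem tensToPow_tpowMap {α : Type*} {F : α → C} {X Y : C} (φ : ∀ a, F a ⟶ X) (g : X ⟶ Y) :
    ∀ {n : ℕ} (v : Vec α n),
      tensToPow φ v ≫ tpowMap g n = tensToPow (fun a => φ a ≫ g) v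
  | _, .nil => Category.comp_id _
  | _, .snoc v a => by
    have ih := tensToPow_tpowMap φ g v
    simp only [tensToPow, tpowMap]
    rw [← ih]
    exact tensorHom_comp_tensorHom _ _ _ _

theorem tensHom_tensToPow {α : Type*} {F G : α → C} {X : C} (φ : ∀ a, F a ⟶ G a)
    (ψ : ∀ a, G a ⟶ X) : ∀ {n : ℕ} (v : Vec α n),
      tensHom φ v ≫ tensToPow ψ v = tensToPow (fun a => φ a ≫ ψ a) v
  | _, .nil => Category.comp_id _
  | _, .snoc v a => by
    have ih := tensHom_tensToPow φ ψ v
    simp only [tensToPow, tensHom]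
    rw [← ih]
    exact tensorHom_comp_tensorHom _ _ _ _

theorem tpowAdd_natural {X Y : C} (f : X ⟶ Y) (a : ℕ) : ∀ b : ℕ,
    (tpowMap f a ⊗ₘ tpowMap f b) ≫ (tpowAdd Y a b).hom =
      (tpowAdd X a b).hom ≫ tpowMap f (a + b)
  | 0 => by
    change (tpowMap f a ⊗ₘ 𝟙 (𝟙_ C)) ≫ (ρ_ _).hom = (ρ_ _).hom ≫ tpowMap f a
    rw [tensorHom_id, rightUnitor_naturality]
  | b + 1 => by
    have ih := tpowAdd_natural f a b
    change (tpowMap f a ⊗ₘ (tpowMap f b ⊗ₘ f)) ≫ (α_ _ _ _).inv ≫ (tpowAdd Y a b).hom ▷ Y =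
      ((α_ _ _ _).inv ≫ (tpowAdd X a b).hom ▷ X) ≫ (tpowMap f (a + b) ⊗ₘ f)
    rw [associator_inv_naturality_assoc, tensorHom_comp_whiskerRight, ih, Category.assoc,
      whiskerRight_comp_tensorHom]

variable [SymmetricCategory C]

/-- Induction on the number of blocks; appending a block costs one use of the naturality of
`tensorμ` and one of that of `tpowAdd`. -/
theorem unzipPow_natural (F : ℕ → C) {X Y : C} (f : X ⟶ Y) : ∀ {n : ℕ} (k : Vec ℕ n),
    tensHom (F := fun a => F a ⊗ tpow X a) (G := fun a => F a ⊗ tpow Y a)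
        (fun a => F a ◁ tpowMap f a) k ≫ unzipPow F Y k =
      unzipPow F X k ≫ tens F k ◁ tpowMap f k.sum
  | _, .nil => by
    refine (Category.id_comp _).trans ((Category.comp_id _).symm.trans ?_)
    exact congrArg _ (whiskerLeft_id _ _).symm
  | _, .snoc k a => by
    have ih := unzipPow_natural F f k
    -- The inductive step is proved for arbitrary objects, so that rewriting never has to unfold the
    -- recursively defined tensor products.
    have aux : ∀ {T T' U V V' Q A A' D D' : C} (e : T ⟶ T') (z : T ⟶ U ⊗ V) (z' : T' ⟶ U ⊗ V')
        (g : V ⟶ V') (p : A ⟶ A') (m : V ⊗ A ⟶ D) (m' : V' ⊗ A' ⟶ D') (h : D ⟶ D'),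
        e ≫ z' = z ≫ U ◁ g → (g ⊗ₘ p) ≫ m' = m ≫ h →
        (e ⊗ₘ (Q ◁ p)) ≫ z' ▷ (Q ⊗ A') ≫ tensorμ U V' Q A' ≫ (U ⊗ Q) ◁ m' =
          (z ▷ (Q ⊗ A) ≫ tensorμ U V Q A ≫ (U ⊗ Q) ◁ m) ≫ (U ⊗ Q) ◁ h := by
      intro T T' U V V' Q A A' D D' e z z' g p m m' h h₁ h₂
      have nat := tensorμ_natural (𝟙 U) g (𝟙 Q) p
      simp only [id_tensorHom, whiskerLeft_id] at nat
      rw [tensorHom_comp_whiskerRight_assoc, h₁]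
      simp only [Category.assoc]
      rw [← whiskerLeft_comp, ← h₂, whiskerLeft_comp, ← reassoc_of% nat,
        whiskerRight_comp_tensorHom_assoc]
    exact aux _ _ _ _ _ _ _ _ ih (tpowAdd_natural f k.sum a)

variable (P : SymmOperad C)

/-- Once the factors are separated, `f` acts on the power of `X` and the composition on the operad
factors, so the two commute by the interchange law. -/
theorem opComp_natural {X Y : C} (f : X ⟶ Y) {n : ℕ} (k : Vec ℕ n) :
    P.obj n ◁ tensHom (F := fun a => P.obj a ⊗ tpow X a) (G := fun a => P.obj a ⊗ tpow Y a)
        (fun a => P.obj a ◁ tpowMap f a) k ≫ opComp P Y k =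
      opComp P X k ≫ P.obj k.sum ◁ tpowMap f k.sum := by
  simp only [opComp, Category.assoc]
  rw [← whiskerLeft_comp_assoc, unzipPow_natural, whiskerLeft_comp_assoc,
    associator_inv_naturality_right_assoc, whisker_exchange]

end Naturality

/-! ### Additivity of the tensor product. -/

section Whisker

variable {C : Type u} [Category.{v} C] [Abelian C] [MonoidalCategory C] [MonoidalClosed C]

/-- Closedness makes `L ⊗ -` a left adjoint. It therefore preserves binary coproducts, hence
biproducts, and a functor between preadditive categories that preserves biproducts is additive. -/
theorem whiskerLeft_sub_of_closed (L : C) {V W : C} (f g : V ⟶ W) :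
    L ◁ (f - g) = L ◁ f - L ◁ g := by
  have : PreservesColimitsOfSize.{0, 0} (tensorLeft L) :=
    (ihom.adjunction L).leftAdjoint_preservesColimits
  have : (tensorLeft L).PreservesZeroMorphisms := ⟨fun V W => whiskerLeft_zero_of_closed L V W⟩
  have := preservesBinaryBiproducts_of_preservesBinaryCoproducts (tensorLeft L)
  have := Functor.additive_of_preservesBinaryBiproducts (tensorLeft L)
  exact (tensorLeft L).map_sub

/-- The case `n = 0` has to be excluded: the empty tensor power of any morphism is the identity of
the unit object. -/
theorem tpowMap_zero (X Y : C) {n : ℕ} (hn : n ≠ 0) : tpowMap (0 : X ⟶ Y) n = 0 := by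
  cases n with
  | zero => exact absurd rfl hn
  | succ n =>
    change tpowMap (0 : X ⟶ Y) n ⊗ₘ (0 : X ⟶ Y) = 0
    rw [MonoidalCategory.tensorHom_def, whiskerLeft_zero_of_closed, comp_zero]

theorem isZero_tensor_left [SymmetricCategory C] {Z : C} (hZ : IsZero Z) (V : C) : IsZero (Z ⊗ V) := by
  refine IsZero.of_iso ?_ (β_ Z V)
  rw [IsZero.iff_id_eq_zero, ← whiskerLeft_id, hZ.eq_of_src (𝟙 Z) 0, whiskerLeft_zero_of_closed]

end Whisker

/-! ### Naturality of the unit and the multiplication of the Schur functor. -/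

section SchurFunctor

variable {C : Type u} [Category.{v} C] [Abelian C] [HasCoproducts.{0} C] [MonoidalCategory C]
  [SymmetricCategory C] (P : SymmOperad C)

theorem schurOne_natural {X Y : C} (f : X ⟶ Y) :
    schurOne P X ≫ schurMap P f = f ≫ schurOne P Y := by
  have h : (λ_ X).inv ≫ tpowMap f 1 = f ≫ (λ_ Y).inv := by
    change (λ_ X).inv ≫ (𝟙 (𝟙_ C) ⊗ₘ f) = _
    rw [id_tensorHom, leftUnitor_inv_naturality]
  have aux : ∀ {T T' W W' : C} (i : X ⟶ T) (i' : Y ⟶ T') (t : T ⟶ T') (q : P.obj 1 ⊗ T ⟶ W)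
      (q' : P.obj 1 ⊗ T' ⟶ W') (r : W ⟶ W'), i ≫ t = f ≫ i' → q ≫ r = P.obj 1 ◁ t ≫ q' →
      ((λ_ X).inv ≫ (P.one ⊗ₘ i) ≫ q) ≫ r = f ≫ (λ_ Y).inv ≫ (P.one ⊗ₘ i') ≫ q' := by
    intro T T' W W' i i' t q q' r h h'
    rw [Category.assoc, Category.assoc, h', tensorHom_comp_whiskerLeft_assoc, h,
      leftUnitor_inv_naturality_assoc, whiskerLeft_comp_tensorHom_assoc]
  exact aux _ _ _ _ _ _ h (schurι_map P f 1)

variable [MonoidalClosed C]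

/-- Morphisms out of `P(P(X))` are determined on the objects `P n ⊗ ⨂ᵢ (P kᵢ ⊗ X^{⊗ kᵢ})`. There the
multiplication is the operadic composition, which is natural by `opComp_natural`. -/
theorem schurMul_natural {X Y : C} (f : X ⟶ Y) :
    schurMap P (schurMap P f) ≫ schurMul P Y = schurMul P X ≫ schurMap P f := by
  refine schur_hom_ext P fun n => schur_pow_hom_ext P fun k => ?_
  have h : tensToPow (schurι P X) k ≫ tpowMap (schurMap P f) n =
      tensHom (F := fun a => P.obj a ⊗ tpow X a) (G := fun a => P.obj a ⊗ tpow Y a)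
        (fun a => P.obj a ◁ tpowMap f a) k ≫ tensToPow (schurι P Y) k := by
    rw [tensToPow_tpowMap, tensHom_tensToPow]
    simp only [schurι_map]
  rw [reassoc_of% schurι_map, ← whiskerLeft_comp_assoc, h, whiskerLeft_comp_assoc, schurMul_spec,
    reassoc_of% opComp_natural, reassoc_of% schurMul_spec, schurι_map]

/-- Positive tensor powers of the zero morphism vanish, and the summand of arity zero is removed by
`hP`. -/
theorem schurMap_zero (hP : IsZero (P.obj 0)) (X Y : C) : schurMap P (0 : X ⟶ Y) = 0 := by
  refine schur_hom_ext P fun n => ?_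
  rw [comp_zero]
  by_cases hn : n = 0
  · subst hn
    exact (isZero_tensor_left hP _).eq_of_src _ _
  · rw [schurι_map, tpowMap_zero X Y hn, whiskerLeft_zero_of_closed, zero_comp]

/-! ### The splitting of `P(X ⊕ B)` into `P ∘ (B|X)` and `P(B)`. -/

theorem schurMap_inr_relProj (B X : C) :
    schurMap P (biprod.inr : B ⟶ X ⊞ B) ≫ relProj P B X = 0 := by
  refine schur_hom_ext P fun n => ?_
  have h : tpowMap (biprod.inr : B ⟶ X ⊞ B) n ≫ relPowProj B X n = 0 := cokernel.condition _
  rw [reassoc_of% schurι_map, schurι_proj, ← whiskerLeft_comp_assoc, h,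
    whiskerLeft_zero_of_closed, zero_comp, comp_zero]

/-- In each arity this is the formula that defines `relPowIncl`, transported through `P n ⊗ -` by
additivity. -/
theorem relProj_relIncl (B X : C) : relProj P B X ≫ relIncl P B X =
    𝟙 _ - schurMap P (biprod.snd : X ⊞ B ⟶ B) ≫ schurMap P biprod.inr := by
  refine schur_hom_ext P fun n => ?_
  rw [reassoc_of% schurι_proj, schurRelι_incl, ← whiskerLeft_comp_assoc, relPowProj_incl,
    whiskerLeft_sub_of_closed, Preadditive.sub_comp, Preadditive.comp_sub, ← schurMap_comp,
    schurι_map, whiskerLeft_id, Category.id_comp, Category.comp_id]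

/-- In each arity, currying turns cancellation of `P n ⊗ relPowProj` into cancellation of the
cokernel projection `relPowProj` itself. -/
instance (B X : C) : Epi (relProj P B X) :=
  ⟨fun f g h => schurRel_hom_ext P fun n => by
    have h' : P.obj n ◁ relPowProj B X n ≫ schurRelι P B X n ≫ f =
        P.obj n ◁ relPowProj B X n ≫ schurRelι P B X n ≫ g := by
      rw [← reassoc_of% schurι_proj, ← reassoc_of% schurι_proj, h]
    apply MonoidalClosed.curry_injective
    refine relPow_hom_ext ?_
    rw [← MonoidalClosed.curry_natural_left, ← MonoidalClosed.curry_natural_left, h']⟩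

/-- After precomposition with the epimorphism `relProj`, the correction term of `relProj_relIncl`
passes through `P(inr)`, which `relProj` kills. -/
theorem relIncl_relProj (B X : C) : relIncl P B X ≫ relProj P B X = 𝟙 _ := by
  rw [← cancel_epi (relProj P B X), reassoc_of% relProj_relIncl, Preadditive.sub_comp,
    Category.assoc, schurMap_inr_relProj, comp_zero, sub_zero, Category.id_comp, Category.comp_id]

/-- The morphism `P ∘ (B|X) ⊕ P(B) → P(X ⊕ B)` identifying the two objects. -/
def relSum (B X : C) : schurRel P B X ⊞ schur P B ⟶ schur P (X ⊞ B) :=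
  biprod.desc (relIncl P B X) (schurMap P biprod.inr)

theorem relSum_snd (B X : C) : relSum P B X ≫ schurMap P biprod.snd = biprod.snd := by
  apply biprod.hom_ext'
  · rw [relSum, biprod.inl_desc_assoc, relIncl_snd, biprod.inl_snd]
  · rw [relSum, biprod.inr_desc_assoc, ← schurMap_comp, biprod.inr_snd, schurMap_id,
      biprod.inr_snd]

theorem relSum_proj (B X : C) : relSum P B X ≫ relProj P B X = biprod.fst := by
  apply biprod.hom_ext'
  · rw [relSum, biprod.inl_desc_assoc, relIncl_relProj, biprod.inl_fst]
  · rw [relSum, biprod.inr_desc_assoc, schurMap_inr_relProj, biprod.inr_fst]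

theorem lift_relSum (B X : C) :
    biprod.lift (relProj P B X) (schurMap P biprod.snd) ≫ relSum P B X = 𝟙 _ := by
  rw [relSum, biprod.lift_desc, relProj_relIncl, sub_add_cancel]

instance (B X : C) : IsSplitEpi (relSum P B X) :=
  IsSplitEpi.mk' ⟨_, lift_relSum P B X⟩

/-- Allows identities of morphisms out of `P(P(X ⊕ B))` to be tested on `P(P ∘ (B|X) ⊕ P(B))`.
Applying `P` keeps `relSum` an epimorphism because it is split. -/
instance (B X : C) : Epi (schurMap P (relSum P B X)) :=
  have : IsSplitEpi (schurMap P (relSum P B X)) := IsSplitEpi.mk'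
    ⟨schurMap P (biprod.lift (relProj P B X) (schurMap P biprod.snd)), by
      rw [← schurMap_comp, lift_relSum, schurMap_id]⟩
  inferInstance

/-- The multiplication of `P(X ⊕ B)` is compatible with the projections to the summands
`P ∘ (B|X)`. -/
theorem relProj_relMul (B X : C) : relProj P (schur P B) (schurRel P B X) ≫ relMul P B X =
    schurMap P (relSum P B X) ≫ schurMul P (X ⊞ B) ≫ relProj P B X := by
  have h : (biprod.inr : schur P B ⟶ schurRel P B X ⊞ schur P B) ≫ relSum P B X =
      schurMap P biprod.inr := biprod.inr_desc _ _
  change relProj P _ _ ≫ relIncl P _ _ ≫ schurMap P (relSum P B X) ≫ _ = _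
  -- The correction term factors through `P(P(inr))`; naturality of the multiplication turns this
  -- into a factor `P(inr)` just before `relProj`, so the term vanishes.
  rw [reassoc_of% relProj_relIncl, Preadditive.sub_comp, Category.id_comp, Category.assoc,
    ← reassoc_of% (schurMap_comp P (biprod.inr : schur P B ⟶ schurRel P B X ⊞ schur P B)), h,
    reassoc_of% schurMul_natural, schurMap_inr_relProj, comp_zero, comp_zero, sub_zero]

/-- Naturality moves the projection to `B` across the multiplication, where it becomes `P` of the
projection to the summand `P(B)`; `relIncl` is killed by that. -/
theorem relIncl_mul_snd (B X : C) : relIncl P (schur P B) (schurRel P B X) ≫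
    schurMap P (relSum P B X) ≫ schurMul P (X ⊞ B) ≫ schurMap P biprod.snd = 0 := by
  rw [← schurMul_natural, ← reassoc_of% schurMap_comp, relSum_snd, reassoc_of% relIncl_snd,
    zero_comp]

/-- The final projection in `relMul` loses nothing, because by `relIncl_mul_snd` the restricted
multiplication has no component in `P(B)`. -/
theorem relMul_relIncl (B X : C) : relMul P B X ≫ relIncl P B X =
    relIncl P (schur P B) (schurRel P B X) ≫ schurMap P (relSum P B X) ≫ schurMul P (X ⊞ B) := by
  change (relIncl P _ _ ≫ schurMap P (relSum P B X) ≫ _ ≫ relProj P B X) ≫ _ = _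
  simp only [Category.assoc]
  rw [relProj_relIncl, Preadditive.comp_sub, Preadditive.comp_sub, Preadditive.comp_sub,
    Category.comp_id, reassoc_of% relIncl_mul_snd, zero_comp, sub_zero]

end SchurFunctor

/-! ### Part (a): the semidirect product of an action. -/

section Equivalence

variable {C : Type u} [Category.{v} C] [Abelian C] [HasCoproducts.{0} C] [MonoidalCategory C]
  [SymmetricCategory C] [MonoidalClosed C] {P : SymmOperad C}

/-- This is the diagonal matrix of part (a): `relSum` followed by the two projections of `P(X ⊕ B)`
gives those of the direct sum. -/
theorem Act.relSum_semidirectStr (S : Act P) :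
    relSum P S.B.carrier S.X.carrier ≫ S.semidirectStr = biprod.map S.ρ S.B.str := by
  apply biprod.hom_ext
  · rw [Act.semidirectStr, Category.assoc, biprod.lift_fst, reassoc_of% relSum_proj,
      biprod.map_fst]
  · rw [Act.semidirectStr, Category.assoc, biprod.lift_snd, reassoc_of% relSum_snd,
      biprod.map_snd]

theorem Act.isSemidirect (hP : IsZero (P.obj 0)) (S : Act P) : S.IsSemidirect where
  unit := by
    apply biprod.hom_ext
    · rw [Act.semidirectStr, Category.assoc, biprod.lift_fst, Category.id_comp]
      apply biprod.hom_ext'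
      · have h := S.isAction.compat
        rw [Category.assoc] at h
        rw [← reassoc_of% schurOne_natural, h, S.X.unit, biprod.inl_fst]
      -- On `B` the unit factors through `P(inr)`, so its component in `X` is zero.
      · rw [← reassoc_of% schurOne_natural, reassoc_of% schurMap_inr_relProj, zero_comp,
          comp_zero, biprod.inr_fst]
    · rw [Act.semidirectStr, Category.assoc, biprod.lift_snd, reassoc_of% schurOne_natural,
        S.B.unit, Category.comp_id, Category.id_comp]
  assoc := by
    apply biprod.hom_ext
    -- Component in `X`: on the decomposed source the inner structure morphism is diagonal, so both
    -- sides factor through `relProj`, and what remains is the associativity of the action.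
    · rw [← cancel_epi (schurMap P (relSum P S.B.carrier S.X.carrier)), Category.assoc,
        ← reassoc_of% schurMap_comp, S.relSum_semidirectStr, Category.assoc, Act.semidirectStr,
        biprod.lift_fst, ← reassoc_of% relProj_natural, ← S.isAction.assoc,
        reassoc_of% relProj_relMul]
    -- Component in `B`: the projection `snd` intertwines the two structure morphisms, which reduces
    -- the claim to associativity of `B`.
    · have h : schurMap P S.semidirectStr ≫ schurMap P biprod.snd =
          schurMap P (schurMap P biprod.snd) ≫ schurMap P S.B.str := by
        rw [← schurMap_comp, ← schurMap_comp, Act.semidirectStr, biprod.lift_snd]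
      rw [Category.assoc, Category.assoc]
      nth_rw 2 [Act.semidirectStr]
      rw [Act.semidirectStr, biprod.lift_snd]
      -- The copy under `schurMap` is folded back so that `h` applies.
      rw [← Act.semidirectStr, reassoc_of% h, S.B.assoc, reassoc_of% schurMul_natural]
  inl_comm := by
    apply biprod.hom_ext
    · have h := S.isAction.compat
      rw [Category.assoc] at h
      rw [Act.semidirectStr, Category.assoc, biprod.lift_fst, h, Category.assoc, biprod.inl_fst,
        Category.comp_id]
    -- The component of `P(X)` in `B` is `P(0)`, which vanishes because there are no operations of
    -- arity zero.
    · rw [Act.semidirectStr, Category.assoc, biprod.lift_snd, ← reassoc_of% schurMap_comp,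
        biprod.inl_snd, schurMap_zero P hP, zero_comp, Category.assoc, biprod.inl_snd, comp_zero]
  inr_comm := by
    apply biprod.hom_ext
    · rw [Act.semidirectStr, Category.assoc, biprod.lift_fst, reassoc_of% schurMap_inr_relProj,
        zero_comp, Category.assoc, biprod.inr_fst, comp_zero]
    · rw [Act.semidirectStr, Category.assoc, biprod.lift_snd, ← reassoc_of% schurMap_comp,
        biprod.inr_snd, schurMap_id, Category.id_comp, Category.assoc, biprod.inr_snd,
        Category.comp_id]

/-! ### Part (b): the action of a split short exact sequence. -/

/-- On `P ∘ (B|X)` this is the defining property of `ρ`; on `P(B)` it says that `s` is a morphism of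
algebras. -/
theorem SplitExt.relSum_desc (S : SplitExt P) :
    relSum P S.B.carrier S.X.carrier ≫ schurMap P (biprod.desc S.i.hom S.s.hom) ≫ S.E.str =
      biprod.map S.ρ S.B.str ≫ biprod.desc S.i.hom S.s.hom := by
  apply biprod.hom_ext'
  · rw [relSum, biprod.inl_desc_assoc, biprod.inl_map_assoc, biprod.inl_desc, S.ρ_comp]
    rfl
  · rw [relSum, biprod.inr_desc_assoc, biprod.inr_map_assoc, biprod.inr_desc,
      ← reassoc_of% schurMap_comp, biprod.inr_desc, S.s.comm]

/-- Both axioms are checked after composition with the monomorphism `i`. -/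
theorem SplitExt.isInternalAction (hP : IsZero (P.obj 0)) (S : SplitExt P) :
    IsInternalAction S.B S.X S.ρ where
  compat := by
    have : Mono S.i.hom := S.exact.mono_f
    rw [← cancel_mono S.i.hom, Category.assoc, Category.assoc, S.ρ_comp, SplitExt.preAction,
      -- The correction term restricted to `P(X)` contains `P(0) = 0`; the rest says that `i` is a
      -- morphism of algebras.
      reassoc_of% relProj_relIncl, Preadditive.sub_comp, Preadditive.comp_sub, Category.assoc,
      ← reassoc_of% (schurMap_comp P (biprod.inl : S.X.carrier ⟶ S.X.carrier ⊞ S.B.carrier)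
        biprod.snd), biprod.inl_snd, schurMap_zero P hP, zero_comp, sub_zero, Category.id_comp,
      ← reassoc_of% schurMap_comp, biprod.inl_desc, S.i.comm]
  assoc := by
    have : Mono S.i.hom := S.exact.mono_f
    -- By `relMul_relIncl` the left side is evaluation in `E` after the multiplication;
    -- associativity of `E` makes it evaluation in two stages, and `relSum_desc` identifies the
    -- inner stage with the pair formed by `ρ` and the structure of `B`.
    rw [← cancel_mono S.i.hom, Category.assoc, Category.assoc, S.ρ_comp, SplitExt.preAction,
      reassoc_of% relMul_relIncl, ← reassoc_of% schurMul_natural, ← S.E.assoc,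
      reassoc_of% relIncl_natural, ← reassoc_of% schurMap_comp, ← reassoc_of% schurMap_comp,
      ← reassoc_of% schurMap_comp, ← S.relSum_desc, Category.assoc]

/-! ### Part (c): the two round trips. -/

/-- The action recovered from the semidirect product of an action is the given one. -/
theorem Act.toSplitExt_ρ (S : Act P) (hS : S.IsSemidirect) : (S.toSplitExt hS).ρ = S.ρ := by
  have : Mono (S.toSplitExt hS).i.hom := (S.toSplitExt hS).exact.mono_f
  refine (cancel_mono (S.toSplitExt hS).i.hom).1 ((SplitExt.ρ_comp _).trans ?_)
  change relIncl P S.B.carrier S.X.carrier ≫ schurMap P (biprod.desc biprod.inl biprod.inr) ≫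
    S.semidirectStr = S.ρ ≫ biprod.inl
  have h : biprod.desc biprod.inl biprod.inr = 𝟙 (S.X.carrier ⊞ S.B.carrier) := by ext <;> simp
  rw [h, schurMap_id, Category.id_comp, Act.semidirectStr]
  apply biprod.hom_ext
  · rw [Category.assoc, biprod.lift_fst, reassoc_of% relIncl_relProj, Category.assoc,
      biprod.inl_fst, Category.comp_id]
  · rw [Category.assoc, biprod.lift_snd, reassoc_of% relIncl_snd, zero_comp, Category.assoc,
      biprod.inl_snd, comp_zero]

/-- Algebras with the same underlying objects and actions define isomorphic objects. -/
def Act.isoOfEq {B X : PAlg P} {ρ ρ' : schurRel P B.carrier X.carrier ⟶ X.carrier}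
    (h : IsInternalAction B X ρ) (h' : IsInternalAction B X ρ') (e : ρ = ρ') :
    (⟨B, X, ρ, h⟩ : Act P) ≅ ⟨B, X, ρ', h'⟩ where
  hom := ⟨𝟙 B, 𝟙 X, by
    change schurRelMap P (𝟙 _) (𝟙 _) ≫ ρ' = ρ ≫ 𝟙 _
    rw [schurRelMap_id, Category.id_comp, Category.comp_id, e]⟩
  inv := ⟨𝟙 B, 𝟙 X, by
    change schurRelMap P (𝟙 _) (𝟙 _) ≫ ρ = ρ' ≫ 𝟙 _
    rw [schurRelMap_id, Category.id_comp, Category.comp_id, e]⟩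
  hom_inv_id := Act.Hom.ext (Category.id_comp _) (Category.id_comp _)
  inv_hom_id := Act.Hom.ext (Category.id_comp _) (Category.id_comp _)

/-- An action is isomorphic to the one recovered from its semidirect product. -/
def actUnitIso (hF : ∀ S : Act P, S.IsSemidirect)
    (hG : ∀ S : SplitExt P, IsInternalAction S.B S.X S.ρ) :
    𝟭 (Act P) ≅ actToSplitExt P hF ⋙ splitExtToAct P hG :=
  NatIso.ofComponents
    (fun S => Act.isoOfEq S.isAction (hG (S.toSplitExt (hF S))) (S.toSplitExt_ρ (hF S)).symm)
    -- The components are identities on both algebras, so naturality consists of unit laws.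
    (fun a => Act.Hom.ext
      ((Category.comp_id a.g).trans (Category.id_comp a.g).symm)
      ((Category.comp_id a.f).trans (Category.id_comp a.f).symm))

/-- The splitting of the underlying short exact sequence. -/
def SplitExt.splitting (S : SplitExt P) :
    (ShortComplex.mk S.i.hom S.p.hom S.zero).Splitting :=
  have := S.exact.mono_f
  ShortComplex.Splitting.ofExactOfSection _ S.exact.exact S.s.hom
    (congrArg PAlg.Hom.hom S.section_comp) this

/-- The inverse of the comparison morphism `X ⊕ B → E`. -/
def SplitExt.toBiprod (S : SplitExt P) : S.E.carrier ⟶ S.X.carrier ⊞ S.B.carrier :=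
  biprod.lift S.splitting.r S.p.hom

theorem SplitExt.toBiprod_desc (S : SplitExt P) :
    S.toBiprod ≫ biprod.desc S.i.hom S.s.hom = 𝟙 _ := by
  rw [toBiprod, biprod.lift_desc]
  exact S.splitting.id

theorem SplitExt.desc_toBiprod (S : SplitExt P) :
    biprod.desc S.i.hom S.s.hom ≫ S.toBiprod = 𝟙 _ := by
  have h₁ : S.i.hom ≫ S.splitting.r = 𝟙 _ := S.splitting.f_r
  have h₂ : S.s.hom ≫ S.splitting.r = 0 := S.splitting.s_r
  have h₃ : S.s.hom ≫ S.p.hom = 𝟙 _ := S.splitting.s_g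
  ext <;> simp [toBiprod, h₁, h₂, h₃, S.zero]

/-- Makes `(i, s)` a morphism of algebras from the semidirect product to `E`. Since `relSum` is an
epimorphism, it suffices to compare on the two summands, which is `relSum_desc`. -/
theorem SplitExt.semidirectStr_desc (S : SplitExt P) (h : IsInternalAction S.B S.X S.ρ) :
    schurMap P (biprod.desc S.i.hom S.s.hom) ≫ S.E.str =
      (⟨S.B, S.X, S.ρ, h⟩ : Act P).semidirectStr ≫ biprod.desc S.i.hom S.s.hom := by
  rw [← cancel_epi (relSum P S.B.carrier S.X.carrier), S.relSum_desc,
    ← Act.relSum_semidirectStr ⟨S.B, S.X, S.ρ, h⟩, Category.assoc]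

/-- A split short exact sequence is isomorphic to the semidirect product of its action. -/
def SplitExt.iso (S : SplitExt P) (hG : IsInternalAction S.B S.X S.ρ)
    (hF : (⟨S.B, S.X, S.ρ, hG⟩ : Act P).IsSemidirect) :
    (⟨S.B, S.X, S.ρ, hG⟩ : Act P).toSplitExt hF ≅ S where
  hom :=
    { f := 𝟙 S.X
      h := ⟨biprod.desc S.i.hom S.s.hom, S.semidirectStr_desc hG⟩
      g := 𝟙 S.B
      comm_i := PAlg.Hom.ext ((biprod.inl_desc _ _).trans (Category.id_comp _).symm)
      comm_p := PAlg.Hom.ext (by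
        change biprod.snd ≫ 𝟙 _ = biprod.desc S.i.hom S.s.hom ≫ S.p.hom
        have h : S.s.hom ≫ S.p.hom = 𝟙 _ := congrArg PAlg.Hom.hom S.section_comp
        ext <;> simp [h, S.zero])
      comm_s := PAlg.Hom.ext ((biprod.inr_desc _ _).trans (Category.id_comp _).symm) }
  inv :=
    { f := 𝟙 S.X
      h := ⟨S.toBiprod, by
        change schurMap P S.toBiprod ≫ (⟨S.B, S.X, S.ρ, hG⟩ : Act P).semidirectStr =
          S.E.str ≫ S.toBiprod
        -- The inverse of a bijective algebra morphism is one too: the compatibility of `(i, s)` is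
        -- conjugated by its inverse.
        have h := S.semidirectStr_desc hG =≫ S.toBiprod
        simp only [Category.assoc] at h
        rw [S.desc_toBiprod, Category.comp_id] at h
        rw [← h, ← reassoc_of% schurMap_comp, S.toBiprod_desc, schurMap_id, Category.id_comp]⟩
      g := 𝟙 S.B
      comm_i := PAlg.Hom.ext (by
        change S.i.hom ≫ S.toBiprod = 𝟙 _ ≫ biprod.inl
        rw [← biprod.inl_desc S.i.hom S.s.hom, Category.assoc, S.desc_toBiprod, Category.comp_id,
          Category.id_comp])
      comm_p := PAlg.Hom.ext ((Category.comp_id _).trans (biprod.lift_snd _ _).symm)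
      comm_s := PAlg.Hom.ext (by
        change S.s.hom ≫ S.toBiprod = 𝟙 _ ≫ biprod.inr
        rw [← biprod.inr_desc S.i.hom S.s.hom, Category.assoc, S.desc_toBiprod, Category.comp_id,
          Category.id_comp]) }
  hom_inv_id := SplitExt.Hom.ext (Category.id_comp _) (PAlg.Hom.ext S.desc_toBiprod)
    (Category.id_comp _)
  inv_hom_id := SplitExt.Hom.ext (Category.id_comp _) (PAlg.Hom.ext S.toBiprod_desc)
    (Category.id_comp _)

/-- The natural isomorphism between a split short exact sequence and the semidirect product of its
action. -/
def splitExtCounitIso (hF : ∀ S : Act P, S.IsSemidirect)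
    (hG : ∀ S : SplitExt P, IsInternalAction S.B S.X S.ρ) :
    splitExtToAct P hG ⋙ actToSplitExt P hF ≅ 𝟭 (SplitExt P) :=
  NatIso.ofComponents (fun S => S.iso (hG S) (hF _))
    (fun {S T} a => SplitExt.Hom.ext
      ((Category.comp_id a.f).trans (Category.id_comp a.f).symm)
      (PAlg.Hom.ext (by
        have hi : S.i.hom ≫ a.h.hom = a.f.hom ≫ T.i.hom := congrArg PAlg.Hom.hom a.comm_i
        have hs : S.s.hom ≫ a.h.hom = a.g.hom ≫ T.s.hom := congrArg PAlg.Hom.hom a.comm_s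
        change biprod.map a.f.hom a.g.hom ≫ biprod.desc T.i.hom T.s.hom =
          biprod.desc S.i.hom S.s.hom ≫ a.h.hom
        ext <;> simp [hi, hs]))
      ((Category.comp_id a.g).trans (Category.id_comp a.g).symm))

end Equivalence

end OperadAction

end

/-! ### The equivalence of categories. -/

theorem mainTheorem6 {C : Type u} [Category.{v} C] [Abelian C] [HasLimits C] [HasColimits C]
    [MonoidalCategory C] [SymmetricCategory C] [MonoidalClosed C]
    (P : OperadAction.SymmOperad C) (hP : P.IsReduced) :
    ∃ (hF : ∀ S : OperadAction.Act P, S.IsSemidirect)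
      (hG : ∀ S : OperadAction.SplitExt P, OperadAction.IsInternalAction S.B S.X S.ρ)
      (e : OperadAction.Act P ≌ OperadAction.SplitExt P),
      e.functor = OperadAction.actToSplitExt P hF ∧
        e.inverse = OperadAction.splitExtToAct P hG := by
  have hF : ∀ S : OperadAction.Act P, S.IsSemidirect := fun S => S.isSemidirect hP.isZero_zero
  have hG : ∀ S : OperadAction.SplitExt P, OperadAction.IsInternalAction S.B S.X S.ρ :=
    fun S => S.isInternalAction hP.isZero_zero
  -- `Equivalence.mk` adjusts only the unit, to obtain the triangle identity; the functors are kept,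
  -- so both final equalities hold by `rfl`.
  exact ⟨hF, hG, CategoryTheory.Equivalence.mk (OperadAction.actToSplitExt P hF)
    (OperadAction.splitExtToAct P hG) (OperadAction.actUnitIso hF hG)
    (OperadAction.splitExtCounitIso hF hG), rfl, rfl⟩
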